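/- Let $\zeta$ be the Riemann zeta function, $\Upsilon(s)=\pi^{-s/2}\,\Gamma(s/2)\,\zeta(s)$ and $\xi(s)=(s-1)\,\pi^{-s/2}\,\zeta(s)\,\Gamma(1+s/2)$; subscripts $R$ and $I$ denote real and imaginary parts. For $s=\sigma+it$ with $0<\sigma<1$ and $t\in\mathbb{R}$, and for $v\in\mathbb{R}$, put $$M(s,v)=-\frac{(2s-1)\,s}{(2iv-1+s)(2iv-s)}+\frac{1}{2iv-s},\qquad M_R=\Re M,\quad M_I=\Im M,$$ $$T_1(s,v)=-M_I(s,v)+M_I(s,-v),\qquad T_2(s,v)=-M_R(s,v)-M_R(s,-v)+4,$$ $$T_3(s,v)=M_R(s,v)-M_R(s,-v),\qquad T_4(s,v)=-M_I(s,v)-M_I(s,-v).$$ Then for every $\sigma\in(0,1)$ and $t\in\mathbb{R}$ the following hold. (a) For all real $v$, $$T_1=\frac{2\sigma v-t}{(t-2v)^2+(\sigma-1)^2}+\frac{2(1-\sigma)v-t}{(t-2v)^2+\sigma^2}+\frac{2\sigma v+t}{(t+2v)^2+(\sigma-1)^2}+\frac{2(1-\sigma)v+t}{(t+2v)^2+\sigma^2},$$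 $$T_2=\frac{-t(t-2v)+(1-\sigma)\sigma}{(t-2v)^2+\sigma^2}+\frac{-t(t-2v)+(1-\sigma)\sigma}{(t-2v)^2+(1-\sigma)^2}+\frac{-t(t+2v)+(1-\sigma)\sigma}{(t+2v)^2+\sigma^2}+\frac{-t(t+2v)+(1-\sigma)\sigma}{(t+2v)^2+(1-\sigma)^2}+4,$$ $$T_3=\frac{-t(t-2v)-\sigma(\sigma-1)}{(t-2v)^2+(\sigma-1)^2}+\frac{t(t-2v)+\sigma(\sigma-1)}{(t-2v)^2+\sigma^2}+\frac{t(t+2v)+\sigma(\sigma-1)}{(t+2v)^2+(\sigma-1)^2}+\frac{-t(t+2v)-\sigma(\sigma-1)}{(t+2v)^2+\sigma^2},$$ $$T_4=\frac{-2v(\sigma-1)-t}{(t-2v)^2+\sigma^2}+\frac{-2\sigma v+t}{(t-2v)^2+(\sigma-1)^2}+\frac{2\sigma v+t}{(t+2v)^2+(\sigma-1)^2}+\frac{2v(\sigma-1)-t}{(t+2v)^2+\sigma^2}.$$ (b) $$1-\frac{\pi^{1/4}}{2\,\Gamma(3/4)}-\xi(s)=-\frac{i}{\pi}\int_{-\infty}^{\infty}M(s,v)\,\Upsilon(2iv)\,v\,dv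 .$$ (c) $$\frac{\pi^{1/4}}{2\,\Gamma(3/4)}-1=-\xi_R(s)+\frac1\pi\int_0^\infty\bigl(T_1(s,v)\,\Upsilon_R(2iv)+(T_2(s,v)-4)\,\Upsilon_I(2iv)\bigr)\,v\,dv .$$ (d) $$\xi_R(s)=\frac1\pi\int_0^\infty\bigl(T_1(s,v)\,\Upsilon_R(2iv)+T_2(s,v)\,\Upsilon_I(2iv)\bigr)\,v\,dv .$$ (e) $$\xi_I(s)=\frac1\pi\int_0^\infty\bigl(T_3(s,v)\,\Upsilon_R(2iv)+T_4(s,v)\,\Upsilon_I(2iv)\bigr)\,v\,dv .$$ All four integrals converge absolutely. -/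

import Mathlib

/-- The function `Υ(s) = π^(-s/2) Γ(s/2) ζ(s)`. -/
noncomputable def upsilonFn (s : ℂ) : ℂ :=
  riemannZeta s * Complex.Gamma (s / 2) * (Real.pi : ℂ) ^ (-s / 2)

/-- Riemann's function `ξ(s) = (s - 1) π^(-s/2) ζ(s) Γ(1 + s/2)`. -/
noncomputable def riemannXiFn (s : ℂ) : ℂ :=
  (s - 1) * (Real.pi : ℂ) ^ (-s / 2) * riemannZeta s * Complex.Gamma (1 + s / 2)

/-- The transfer function on the line `c = -1`:
`M(s, v) = -(2s - 1) s / ((2iv - 1 + s) (2iv - s)) + 1 / (2iv - s)`. -/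
noncomputable def transferM (s : ℂ) (v : ℝ) : ℂ :=
  -((2 * s - 1) * s / ((2 * Complex.I * v - 1 + s) * (2 * Complex.I * v - s)))
    + (2 * Complex.I * v - s)⁻¹

/-- The real part of the transfer function. -/
noncomputable def transferMR (s : ℂ) (v : ℝ) : ℝ := (transferM s v).re

/-- The imaginary part of the transfer function. -/
noncomputable def transferMI (s : ℂ) (v : ℝ) : ℝ := (transferM s v).im

noncomputable def kernelT₁ (s : ℂ) (v : ℝ) : ℝ := -transferMI s v + transferMI s (-v)

noncomputable def kernelT₂ (s : ℂ) (v : ℝ) : ℝ := -transferMR s v - transferMR s (-v) + 4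

noncomputable def kernelT₃ (s : ℂ) (v : ℝ) : ℝ := transferMR s v - transferMR s (-v)

noncomputable def kernelT₄ (s : ℂ) (v : ℝ) : ℝ := -transferMI s v - transferMI s (-v)

/-- The real part `Υ_R(2iv)`. -/
noncomputable def upsilonR (v : ℝ) : ℝ := (upsilonFn (2 * Complex.I * v)).re

/-- The imaginary part `Υ_I(2iv)`. -/
noncomputable def upsilonI (v : ℝ) : ℝ := (upsilonFn (2 * Complex.I * v)).im

/-! Write `w = 2iv` and let `Λ` be the completed zeta function, which equals `Υ` on this line for `v
≠ 0`. Partial fractions give `M = (1 - s)/(w - s) + s/(w - (1 - s))`, so `w M = 1 + s(1 - s)[1/(w -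
s) + 1/(w - (1 - s))]`. Splitting `Λ(w) = Λ₀(w) - 1/(w(1 - w))` with `Λ₀` entire reduces the
integral in (b) to three pieces. The integral of `Λ₀(2iv)` is Mellin inversion of the theta function
at `x = 1`, and equals `π(θ₃(1) - 1)`. The integral of `Λ₀` against the two Cauchy kernels is `-π
Λ₀(s)`: each kernel is a moment over `(0, 1]`, Fubini and Mellin inversion turn it into half of a
Mellin integral, and `x ↦ 1/x` makes the halves fit. The pole part integrates to `0`, since all its
poles lie to the right of the line. As `ξ(s) = (1 - s(1 - s)Λ₀(s))/2`, this is (b) with `θ₃(1)/2` as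
the constant. The value `θ₃(1) = π^(1/4)/Γ(3/4)` comes from Gauss: `(θ₃², θ₄²)` at `2ⁿ` is an
arithmetic-geometric mean sequence with limit `(1, 1)`, the elliptic integral `agmIntegral` is
invariant along it, and at `x = 1` the ratio `θ₄²/θ₃²` is `1/√2`, the lemniscatic case. Since
`Υ(-2iv)` is the conjugate of `Υ(2iv)`, folding (b) at the origin and taking real and imaginary
parts gives (c) and (e). Passing from (c) to (d) needs `∫₀^∞ Υ_I(2iv) v dv`; it is found by letting
`s = 1/2 + it`, `t → ∞` in (b), where `M → 2` and, by Phragmén–Lindelöf, `ξ(s) → 0`. -/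

open MeasureTheory Set Filter Topology Asymptotics

/-! ### Theta constants and their doubling formulas. -/

/-- Jacobi's `θ₃(x) = ∑ₙ exp (-π n² x)`. -/
noncomputable def thetaThree (x : ℝ) : ℝ := ∑' n : ℤ, Real.exp (-Real.pi * n ^ 2 * x)

/-- Jacobi's `θ₄(x) = ∑ₙ (-1)ⁿ exp (-π n² x)`. -/
noncomputable def thetaFour (x : ℝ) : ℝ := ∑' n : ℤ, (-1) ^ n * Real.exp (-Real.pi * n ^ 2 * x)

lemma thetaThree_hasSum {x : ℝ} (hx : 0 < x) :
    HasSum (fun n : ℤ ↦ Real.exp (-Real.pi * n ^ 2 * x)) (thetaThree x) := by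
  have := HurwitzZeta.hasSum_int_evenKernel 0 hx
  simp only [add_zero] at this
  exact this.summable.hasSum

lemma thetaThree_eq_evenKernel {x : ℝ} (hx : 0 < x) :
    thetaThree x = HurwitzZeta.evenKernel 0 x := by
  have := HurwitzZeta.hasSum_int_evenKernel 0 hx
  simp only [add_zero] at this
  simpa using (thetaThree_hasSum hx).unique this

lemma thetaFour_summable_norm {x : ℝ} (hx : 0 < x) :
    Summable fun n : ℤ ↦ ‖(-1 : ℝ) ^ n * Real.exp (-Real.pi * n ^ 2 * x)‖ := by
  simpa [abs_zpow] using (thetaThree_hasSum hx).summable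

lemma thetaFour_hasSum {x : ℝ} (hx : 0 < x) :
    HasSum (fun n : ℤ ↦ (-1) ^ n * Real.exp (-Real.pi * n ^ 2 * x)) (thetaFour x) :=
  (thetaFour_summable_norm hx).of_norm.hasSum

lemma one_le_thetaThree {x : ℝ} (hx : 0 < x) : 1 ≤ thetaThree x := by
  simpa [thetaThree] using (thetaThree_hasSum hx).summable.le_tsum 0 fun n _ ↦ (Real.exp_pos _).le

lemma thetaThree_add_thetaFour {x : ℝ} (hx : 0 < x) :
    thetaThree x + thetaFour x = 2 * thetaThree (4 * x) := by
  have h := (thetaThree_hasSum hx).add (thetaFour_hasSum hx)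
  have hi : Function.Injective fun n : ℤ ↦ 2 * n := fun a b hab ↦ by simpa using hab
  refine ((hi.hasSum_iff ?_).mpr h).unique ?_
  · intro n hn
    have : Odd n := by
      rw [← Int.not_even_iff_odd]
      rintro ⟨k, rfl⟩
      exact hn ⟨k, by ring⟩
    simp [this.neg_one_zpow]
  · convert! (thetaThree_hasSum (by positivity : 0 < 4 * x)).mul_left 2 using 2 with n
    simp only [Function.comp, Even.neg_one_zpow (even_two_mul n)]
    push_cast
    ring_nf

/-- The map `(m, n) ↦ (m + n, m - n)` is injective with image the pairs of even sum, so reindexing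
by it loses only terms that vanish. -/
lemma hasSum_comp_add_sub {f : ℤ × ℤ → ℝ} {a : ℝ} (h : HasSum f a)
    (hf : ∀ p : ℤ × ℤ, Odd (p.1 + p.2) → f p = 0) :
    HasSum (fun p : ℤ × ℤ ↦ f (p.1 + p.2, p.1 - p.2)) a := by
  have hi : Function.Injective fun p : ℤ × ℤ ↦ (p.1 + p.2, p.1 - p.2) := fun a b hab ↦ by
    simp only [Prod.mk.injEq] at hab
    ext <;> lia
  refine (hi.hasSum_iff fun p hp ↦ hf p ?_).mpr h
  rw [← Int.not_even_iff_odd]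
  rintro ⟨k, hk⟩
  exact hp ⟨(k, p.1 - k), by ext <;> simp; lia⟩

lemma gaussian_add_mul_sub (x : ℝ) (p : ℤ × ℤ) :
    Real.exp (-Real.pi * ((p.1 + p.2 : ℤ) : ℝ) ^ 2 * x) *
      Real.exp (-Real.pi * ((p.1 - p.2 : ℤ) : ℝ) ^ 2 * x) =
      Real.exp (-Real.pi * p.1 ^ 2 * (2 * x)) * Real.exp (-Real.pi * p.2 ^ 2 * (2 * x)) := by
  rw [← Real.exp_add, ← Real.exp_add]
  push_cast
  ring_nf

lemma neg_one_zpow_mul_self (n : ℤ) : ((-1 : ℝ) ^ n) * (-1) ^ n = 1 := by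
  rw [← zpow_add₀ (by norm_num)]
  exact Even.neg_one_zpow ⟨n, rfl⟩

lemma neg_one_zpow_sub (m n : ℤ) : ((-1 : ℝ) ^ (m - n)) = (-1) ^ m * (-1) ^ n := by
  rw [zpow_sub₀ (by norm_num), div_eq_iff (zpow_ne_zero _ (by norm_num)), mul_assoc,
    neg_one_zpow_mul_self, mul_one]

lemma neg_one_zpow_add (m n : ℤ) : ((-1 : ℝ) ^ (m + n)) = (-1) ^ m * (-1) ^ n :=
  zpow_add₀ (by norm_num) _ _

lemma neg_one_zpow_eq_neg {m n : ℤ} (h : Odd (m + n)) : ((-1 : ℝ) ^ m) = -(-1) ^ n := by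
  have := h.neg_one_zpow (α := ℝ)
  rw [neg_one_zpow_add] at this
  linear_combination this * (-1 : ℝ) ^ n - (-1 : ℝ) ^ m * neg_one_zpow_mul_self n

lemma HasSum.mul_real {f g : ℤ → ℝ} {a b : ℝ} (hf : HasSum f a) (hg : HasSum g b) :
    HasSum (fun p : ℤ × ℤ ↦ f p.1 * g p.2) (a * b) :=
  hf.mul hg (summable_mul_of_summable_norm hf.summable.norm hg.summable.norm)

/-- In the double series for `a² + b²` the factor `1 + (-1)^(m+n)` kills the odd pairs and doubles
the even ones, which are then rotated into the series for `c²`. -/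
lemma sq_add_sq_of_hasSum {E F : ℤ → ℝ} {a b c : ℝ} (h3 : HasSum E a)
    (h4 : HasSum (fun n ↦ (-1) ^ n * E n) b) (h2 : HasSum F c)
    (hE : ∀ p : ℤ × ℤ, E (p.1 + p.2) * E (p.1 - p.2) = F p.1 * F p.2) :
    a ^ 2 + b ^ 2 = 2 * c ^ 2 := by
  have e : HasSum (fun p : ℤ × ℤ ↦
      E p.1 * E p.2 + (-1) ^ p.1 * E p.1 * ((-1) ^ p.2 * E p.2)) (a * a + b * b) :=
    (h3.mul_real h3).add (h4.mul_real h4)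
  have h := hasSum_comp_add_sub e (fun p hp ↦ by
    rw [neg_one_zpow_eq_neg hp]
    linear_combination -E p.1 * E p.2 * neg_one_zpow_mul_self p.2)
  rw [sq, sq, sq]
  refine h.unique ?_
  convert! (h2.mul_real h2).mul_left 2 using 2 with p
  simp only [neg_one_zpow_add, neg_one_zpow_sub]
  linear_combination 2 * hE p + E (p.1 + p.2) * E (p.1 - p.2) *
    ((-1) ^ p.1 * (-1) ^ p.1 * neg_one_zpow_mul_self p.2 + neg_one_zpow_mul_self p.1)

lemma mul_eq_sq_of_hasSum {E F : ℤ → ℝ} {a b c : ℝ} (h3 : HasSum E a)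
    (h4 : HasSum (fun n ↦ (-1) ^ n * E n) b) (h2 : HasSum (fun n ↦ (-1) ^ n * F n) c)
    (hE : ∀ p : ℤ × ℤ, E (p.1 + p.2) * E (p.1 - p.2) = F p.1 * F p.2) :
    a * b = c ^ 2 := by
  have e : HasSum (fun p : ℤ × ℤ ↦
      E p.1 * ((-1) ^ p.2 * E p.2) + (-1) ^ p.1 * E p.1 * E p.2) (a * b + b * a) :=
    (h3.mul_real h4).add (h4.mul_real h3)
  have h := hasSum_comp_add_sub e (fun p hp ↦ by
    rw [neg_one_zpow_eq_neg hp]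
    ring)
  have key : a * b + b * a = 2 * (c * c) := by
    refine h.unique ?_
    convert! (h2.mul_real h2).mul_left 2 using 2 with p
    simp only [neg_one_zpow_add, neg_one_zpow_sub]
    linear_combination 2 * (-1 : ℝ) ^ p.1 * (-1) ^ p.2 * hE p
  linear_combination key / 2

lemma thetaThree_sq_add_thetaFour_sq {x : ℝ} (hx : 0 < x) :
    thetaThree x ^ 2 + thetaFour x ^ 2 = 2 * thetaThree (2 * x) ^ 2 :=
  sq_add_sq_of_hasSum (thetaThree_hasSum hx) (thetaFour_hasSum hx)
    (thetaThree_hasSum (by positivity)) (gaussian_add_mul_sub x)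

lemma thetaThree_mul_thetaFour {x : ℝ} (hx : 0 < x) :
    thetaThree x * thetaFour x = thetaFour (2 * x) ^ 2 :=
  mul_eq_sq_of_hasSum (thetaThree_hasSum hx) (thetaFour_hasSum hx)
    (thetaFour_hasSum (by positivity)) (gaussian_add_mul_sub x)

lemma thetaThree_inv {x : ℝ} (hx : 0 < x) : thetaThree x⁻¹ = Real.sqrt x * thetaThree x := by
  rw [thetaThree_eq_evenKernel hx, thetaThree_eq_evenKernel (inv_pos.mpr hx),
    HurwitzZeta.evenKernel_functional_equation, ← HurwitzZeta.evenKernel_eq_cosKernel_of_zero,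
    Real.sqrt_eq_rpow, Real.inv_rpow hx.le]
  simp

/-- The doubling formulas at `1/2` and `1`, with the inversion relating `1/2` to `2`, express
`θ₃(1/2)²` and `θ₄(1/2)²` as `θ₃(1)² ± θ₄(1)²`; their product is `θ₄(1)⁴`. -/
lemma two_mul_thetaFour_one_pow_four : 2 * thetaFour 1 ^ 4 = thetaThree 1 ^ 4 := by
  have h1 := thetaThree_sq_add_thetaFour_sq one_pos
  have h2 := thetaThree_sq_add_thetaFour_sq (x := 1 / 2) (by norm_num)
  have h3 := thetaThree_mul_thetaFour (x := 1 / 2) (by norm_num)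
  have h4 : thetaThree (1 / 2) ^ 2 = 2 * thetaThree 2 ^ 2 := by
    rw [one_div, thetaThree_inv two_pos, mul_pow, Real.sq_sqrt two_pos.le]
  norm_num at h1 h2 h3
  have h5 : thetaThree (1 / 2) ^ 2 * thetaFour (1 / 2) ^ 2 = thetaFour 1 ^ 4 := by
    rw [← mul_pow, h3]; ring
  have h6 : thetaThree (1 / 2) ^ 2 = thetaThree 1 ^ 2 + thetaFour 1 ^ 2 := by rw [h4, h1]
  have h7 : thetaFour (1 / 2) ^ 2 = thetaThree 1 ^ 2 - thetaFour 1 ^ 2 := by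
    linear_combination h2 - h6
  rw [h6, h7] at h5
  linear_combination -h5

lemma thetaThree_tendsto : Tendsto thetaThree atTop (𝓝 1) := by
  obtain ⟨p, hp, h⟩ := HurwitzZeta.isBigO_atTop_evenKernel_sub 0
  have h0 : Tendsto (fun x : ℝ ↦ Real.exp (-p * x)) atTop (𝓝 0) :=
    Real.tendsto_exp_atBot.comp (tendsto_id.const_mul_atTop_of_neg (neg_lt_zero.mpr hp))
  have := (h.trans_tendsto h0).add_const 1
  simp only [if_true, sub_add_cancel, zero_add] at this
  refine this.congr' ?_
  filter_upwards [eventually_gt_atTop 0] with x hx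
  exact (thetaThree_eq_evenKernel hx).symm

lemma thetaFour_tendsto : Tendsto thetaFour atTop (𝓝 1) := by
  have h : Tendsto (fun x ↦ 2 * thetaThree (4 * x) - thetaThree x) atTop (𝓝 (2 * 1 - 1)) :=
    ((thetaThree_tendsto.comp (tendsto_id.const_mul_atTop (by norm_num : (0 : ℝ) < 4))).const_mul
      2).sub thetaThree_tendsto
  norm_num at h
  refine h.congr' ?_
  filter_upwards [eventually_gt_atTop 0] with x hx
  linarith [thetaThree_add_thetaFour hx]

/-- Each AGM step needs positive means. As only squares of `θ₄` enter, nonvanishing is enough, and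
it propagates through `θ₄(2x)² = θ₃(x) θ₄(x)`. -/
lemma thetaFour_two_pow_ne_zero (n : ℕ) : thetaFour (2 ^ n) ≠ 0 := by
  induction n with
  | zero =>
    intro h
    have := two_mul_thetaFour_one_pow_four
    have h3 := one_le_thetaThree one_pos
    simp only [pow_zero] at h
    rw [h] at this
    have := pow_pos (one_pos.trans_le h3) 4
    linarith
  | succ n ih =>
    intro h
    have := thetaThree_mul_thetaFour (x := 2 ^ n) (by positivity)
    rw [← pow_succ', h] at this
    have h3 := one_le_thetaThree (x := 2 ^ n) (by positivity)
    rcases mul_eq_zero.mp (this.trans (by norm_num)) with h' | h'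
    · linarith
    · exact ih h'

/-! ### The elliptic integral and its invariance under the AGM step. -/

lemma image_half_sub_div {c : ℝ} (hc : 0 < c) :
    (fun x : ℝ ↦ (x - c / x) / 2) '' Ioi 0 = univ := by
  refine eq_univ_of_forall fun t ↦ ?_
  have h0 : t ^ 2 < t ^ 2 + c := by linarith
  have h1 : |t| < √(t ^ 2 + c) := by
    rw [← Real.sqrt_sq_eq_abs]
    exact Real.sqrt_lt_sqrt (sq_nonneg t) h0
  have h2 : 0 < t + √(t ^ 2 + c) := by linarith [neg_abs_le t]
  -- The positive root of `x² - 2tx - c = 0`.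
  refine ⟨t + √(t ^ 2 + c), h2, ?_⟩
  have h3 : √(t ^ 2 + c) ^ 2 = t ^ 2 + c := Real.sq_sqrt (by positivity)
  simp only
  field_simp
  linear_combination h3

lemma injOn_half_sub_div {c : ℝ} (hc : 0 < c) :
    InjOn (fun x : ℝ ↦ (x - c / x) / 2) (Ioi 0) := by
  intro x hx y hy h
  rw [mem_Ioi] at hx hy
  simp only at h
  field_simp at h
  have : (x - y) * (x * y + c) = 0 := by linear_combination h
  rcases mul_eq_zero.mp this with h | h
  · linarith
  · nlinarith [mul_pos hx hy]

lemma integral_eq_integral_Ioi_half_sub_div {c : ℝ} (hc : 0 < c) (g : ℝ → ℝ) :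
    ∫ t, g t = ∫ x in Ioi (0 : ℝ), (1 + c / x ^ 2) / 2 * g ((x - c / x) / 2) := by
  have hd : ∀ x ∈ Ioi (0 : ℝ), HasDerivWithinAt (fun x : ℝ ↦ (x - c / x) / 2)
      ((1 + c / x ^ 2) / 2) (Ioi 0) x := by
    intro x hx
    have h := ((hasDerivAt_id x).sub (((hasDerivAt_inv (ne_of_gt hx)).const_mul c))).div_const 2
    refine (h.congr_deriv ?_).hasDerivWithinAt.congr (fun y _ ↦ ?_) ?_ <;>
      simp [div_eq_mul_inv]
  have := integral_image_eq_integral_abs_deriv_smul measurableSet_Ioi hd (injOn_half_sub_div hc) g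
  rw [image_half_sub_div hc, setIntegral_univ] at this
  rw [this]
  refine setIntegral_congr_fun measurableSet_Ioi fun x hx ↦ ?_
  simp only [smul_eq_mul]
  rw [abs_of_nonneg (by positivity)]

/-- The elliptic integral `∫ dx / √((x² + a²) (x² + b²))` over the real line. -/
noncomputable def agmIntegral (a b : ℝ) : ℝ := ∫ x : ℝ, (√((x ^ 2 + a ^ 2) * (x ^ 2 + b ^ 2)))⁻¹

lemma agmIntegral_eq_Ioi (a b : ℝ) :
    agmIntegral a b = 2 * ∫ x in Ioi (0 : ℝ), (√((x ^ 2 + a ^ 2) * (x ^ 2 + b ^ 2)))⁻¹ := by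
  rw [agmIntegral, ← integral_comp_abs]
  simp

/-- Gauss's transformation: under `t = (x - ab/x)/2` both factors `t² + a'²` and `t² + b'²` become
rational in `x`, with numerators `(x² + a²)(x² + b²)` and `(x² + ab)²`; the Jacobian cancels the
square. -/
lemma agmIntegral_step {a b a' b' : ℝ} (ha : 0 < a) (hb : 0 < b) (h1 : 2 * a' = a + b)
    (h2 : b' ^ 2 = a * b) : agmIntegral a' b' = agmIntegral a b := by
  rw [agmIntegral_eq_Ioi a b, agmIntegral, integral_eq_integral_Ioi_half_sub_div (mul_pos ha hb),
    ← integral_const_mul]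
  refine setIntegral_congr_fun measurableSet_Ioi fun x hx ↦ ?_
  rw [mem_Ioi] at hx
  have e : (((x - a * b / x) / 2) ^ 2 + a' ^ 2) * (((x - a * b / x) / 2) ^ 2 + b' ^ 2) =
      ((x ^ 2 + a * b) / (4 * x ^ 2)) ^ 2 * ((x ^ 2 + a ^ 2) * (x ^ 2 + b ^ 2)) := by
    rw [h2, show a' = (a + b) / 2 by linarith]
    field_simp
    ring
  rw [e, Real.sqrt_mul (by positivity), Real.sqrt_sq (by positivity), mul_inv]
  field_simp
  ring

lemma agmIntegral_mul {c : ℝ} (hc : 0 < c) (a b : ℝ) :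
    agmIntegral (c * a) (c * b) = c⁻¹ * agmIntegral a b := by
  have h := Measure.integral_comp_mul_left
    (fun x ↦ (√((x ^ 2 + (c * a) ^ 2) * (x ^ 2 + (c * b) ^ 2)))⁻¹) c
  rw [abs_of_pos (inv_pos.mpr hc), smul_eq_mul] at h
  have h' : ∀ x : ℝ, (√(((c * x) ^ 2 + (c * a) ^ 2) * ((c * x) ^ 2 + (c * b) ^ 2)))⁻¹ =
      (c ^ 2)⁻¹ * (√((x ^ 2 + a ^ 2) * (x ^ 2 + b ^ 2)))⁻¹ := by
    intro x
    rw [show ((c * x) ^ 2 + (c * a) ^ 2) * ((c * x) ^ 2 + (c * b) ^ 2) =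
      (c ^ 2) ^ 2 * ((x ^ 2 + a ^ 2) * (x ^ 2 + b ^ 2)) by ring, Real.sqrt_mul (by positivity),
      Real.sqrt_sq (by positivity), mul_inv]
  simp_rw [h'] at h
  rw [integral_const_mul] at h
  unfold agmIntegral
  field_simp at h ⊢
  linarith

lemma agmIntegral_tendsto {a b : ℕ → ℝ} (ha : Tendsto a atTop (𝓝 1)) (hb : Tendsto b atTop (𝓝 1)) :
    Tendsto (fun n ↦ agmIntegral (a n) (b n)) atTop (𝓝 Real.pi) := by
  have hlim : Real.pi = ∫ x : ℝ, (√((x ^ 2 + 1 ^ 2) * (x ^ 2 + 1 ^ 2)))⁻¹ := by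
    rw [← integral_univ_inv_one_add_sq]
    congr 1
    ext x
    rw [Real.sqrt_mul_self (by positivity)]
    ring
  rw [hlim]
  -- Any bound below `1` would do; `1/4` gives the dominating function `4/(1 + x²)`.
  have hbig : ∀ {u : ℕ → ℝ}, Tendsto u atTop (𝓝 1) → ∀ᶠ n in atTop, (1 / 4 : ℝ) ≤ u n ^ 2 :=
    fun hu ↦ (hu.pow 2).eventually_const_le (by norm_num)
  refine tendsto_integral_filter_of_dominated_convergence (fun x ↦ 4 * (1 + x ^ 2)⁻¹) ?_ ?_
    (integrable_inv_one_add_sq.const_mul 4) ?_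
  · exact Eventually.of_forall fun n ↦
      (Measurable.inv (by fun_prop)).aestronglyMeasurable
  · filter_upwards [hbig ha, hbig hb] with n h1 h2
    refine ae_of_all _ fun x ↦ ?_
    rw [Real.norm_of_nonneg (by positivity)]
    have h3 : ((1 + x ^ 2) / 4) ^ 2 ≤ (x ^ 2 + a n ^ 2) * (x ^ 2 + b n ^ 2) := by
      rw [sq]
      gcongr <;> nlinarith [sq_nonneg x]
    have h4 := Real.le_sqrt_of_sq_le h3
    calc _ ≤ ((1 + x ^ 2) / 4)⁻¹ := by gcongr
      _ = _ := by rw [inv_div, div_eq_mul_inv]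
  · refine ae_of_all _ fun x ↦ ?_
    refine Tendsto.inv₀ ?_ (by positivity)
    exact ((((ha.pow 2).const_add _).mul ((hb.pow 2).const_add _))).sqrt

lemma agmIntegral_theta :
    agmIntegral (thetaThree 1 ^ 2) (thetaFour 1 ^ 2) = Real.pi := by
  have hpos3 (n : ℕ) : 0 < thetaThree (2 ^ n) :=
    one_pos.trans_le (one_le_thetaThree (by positivity))
  have hconst (n : ℕ) : agmIntegral (thetaThree (2 ^ n) ^ 2) (thetaFour (2 ^ n) ^ 2) =
      agmIntegral (thetaThree 1 ^ 2) (thetaFour 1 ^ 2) := by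
    induction n with
    | zero => simp
    | succ n ih =>
      rw [← ih, pow_succ' (2 : ℝ) n]
      have h4 := thetaFour_two_pow_ne_zero n
      have h2n : (0 : ℝ) < 2 ^ n := by positivity
      refine agmIntegral_step (pow_pos (hpos3 n) 2) (by positivity)
        (thetaThree_sq_add_thetaFour_sq h2n).symm ?_
      rw [← thetaThree_mul_thetaFour h2n]
      ring
  have h2 : Tendsto (fun n : ℕ ↦ (2 : ℝ) ^ n) atTop atTop :=
    tendsto_pow_atTop_atTop_of_one_lt one_lt_two
  have := agmIntegral_tendsto (a := fun n ↦ thetaThree (2 ^ n) ^ 2)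
    (b := fun n ↦ thetaFour (2 ^ n) ^ 2)
    (by simpa using (thetaThree_tendsto.comp h2).pow 2)
    (by simpa using (thetaFour_tendsto.comp h2).pow 2)
  simp_rw [hconst] at this
  exact tendsto_nhds_unique tendsto_const_nhds this

/-! ### The lemniscate integral and the value of `θ₃(1)`. -/

lemma image_pow_four_div :
    (fun x : ℝ ↦ x ^ 4 / (1 + x ^ 4)) '' Ioi 0 = Ioo 0 1 := by
  ext y
  constructor
  · rintro ⟨x, hx, rfl⟩
    rw [mem_Ioi] at hx
    exact ⟨by positivity, (div_lt_one (by positivity)).mpr (by linarith)⟩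
  · rintro ⟨h0, h1⟩
    have h1' : 0 < 1 - y := by linarith
    have h2 : 0 < y / (1 - y) := by positivity
    refine ⟨(y / (1 - y)) ^ (1 / 4 : ℝ), Real.rpow_pos_of_pos h2 _, ?_⟩
    have : ((y / (1 - y)) ^ (1 / 4 : ℝ)) ^ 4 = y / (1 - y) := by
      rw [← Real.rpow_natCast, ← Real.rpow_mul h2.le]
      norm_num
    simp only [this]
    field_simp
    ring

lemma injOn_pow_four_div : InjOn (fun x : ℝ ↦ x ^ 4 / (1 + x ^ 4)) (Ioi 0) := by
  intro x hx y hy h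
  rw [mem_Ioi] at hx hy
  simp only at h
  field_simp at h
  exact (pow_left_inj₀ hx.le hy.le four_ne_zero).mp (by linear_combination h)

/-- The substitution `y = x⁴/(1 + x⁴)` turns the Beta integral `B(1/4, 1/4) = Γ(1/4)²/Γ(1/2)` into
the left side. -/
lemma integral_inv_sqrt_one_add_pow_four :
    4 * ∫ x in Ioi (0 : ℝ), (√(1 + x ^ 4))⁻¹ = Real.Gamma (1 / 4) ^ 2 / √Real.pi := by
  have hd : ∀ x ∈ Ioi (0 : ℝ), HasDerivWithinAt (fun x : ℝ ↦ x ^ 4 / (1 + x ^ 4))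
      (4 * x ^ 3 / (1 + x ^ 4) ^ 2) (Ioi 0) x := by
    intro x hx
    have h := (hasDerivAt_pow 4 x).div ((hasDerivAt_pow 4 x).const_add 1)
      (by positivity : (1 + x ^ 4) ≠ 0)
    refine (h.congr_deriv ?_).hasDerivWithinAt
    push_cast
    ring
  have hbeta : ∫ y in Ioo (0 : ℝ) 1, y ^ (-(3 / 4) : ℝ) * (1 - y) ^ (-(3 / 4) : ℝ) =
      Real.Gamma (1 / 4) ^ 2 / √Real.pi := by
    have h1 := ProbabilityTheory.beta_eq_betaIntegralReal (1 / 4) (1 / 4) (by norm_num)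
      (by norm_num)
    rw [ProbabilityTheory.beta, show (1 / 4 + 1 / 4 : ℝ) = 1 / 2 by norm_num,
      Real.Gamma_one_half_eq, ← sq] at h1
    rw [h1, Complex.betaIntegral, intervalIntegral.integral_of_le zero_le_one,
      integral_Ioc_eq_integral_Ioo]
    rw [← Complex.ofReal_re (∫ y in Ioo (0 : ℝ) 1, y ^ (-(3 / 4) : ℝ) * (1 - y) ^ (-(3 / 4) : ℝ)),
      ← integral_complex_ofReal]
    congr 1
    refine setIntegral_congr_fun measurableSet_Ioo fun y hy ↦ ?_
    rw [Complex.ofReal_mul, Complex.ofReal_cpow hy.1.le, Complex.ofReal_cpow (by linarith [hy.2])]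
    push_cast
    norm_num
  have h := integral_image_eq_integral_abs_deriv_smul measurableSet_Ioi hd injOn_pow_four_div
    (fun y ↦ y ^ (-(3 / 4) : ℝ) * (1 - y) ^ (-(3 / 4) : ℝ))
  rw [image_pow_four_div, hbeta] at h
  rw [h, ← integral_const_mul]
  refine setIntegral_congr_fun measurableSet_Ioi fun x hx ↦ ?_
  rw [mem_Ioi] at hx
  have hp : 0 < 1 + x ^ 4 := by positivity
  have e1 : 1 - x ^ 4 / (1 + x ^ 4) = (1 + x ^ 4)⁻¹ := by field_simp; ring
  have e2 : (x ^ 4) ^ (-(3 / 4) : ℝ) = (x ^ 3)⁻¹ := by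
    rw [← Real.rpow_natCast x 4, ← Real.rpow_mul hx.le, ← Real.rpow_natCast x 3,
      ← Real.rpow_neg hx.le]
    norm_num
  have e3 : (1 + x ^ 4) ^ (-(3 / 4) : ℝ) * (1 + x ^ 4) ^ (-(3 / 4) : ℝ) =
      (1 + x ^ 4)⁻¹ * (√(1 + x ^ 4))⁻¹ := by
    rw [Real.sqrt_eq_rpow, ← Real.rpow_neg_one, ← Real.rpow_neg hp.le, ← Real.rpow_add hp,
      ← Real.rpow_add hp]
    norm_num
  simp only [smul_eq_mul]
  rw [e1, abs_of_pos (by positivity), Real.div_rpow (by positivity) hp.le, e2,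
    Real.inv_rpow hp.le, div_eq_mul_inv _ ((1 + x ^ 4) ^ (-(3 / 4) : ℝ)), mul_assoc (x ^ 3)⁻¹,
    ← mul_inv, e3]
  field_simp
  exact (Real.sq_sqrt hp.le).symm

lemma agmIntegral_one_inv_sqrt_two :
    agmIntegral 1 (√2)⁻¹ = Real.Gamma (1 / 4) ^ 2 / (2 * √Real.pi) := by
  have : agmIntegral 1 (√2)⁻¹ = 2 * ∫ x in Ioi (0 : ℝ), (√(1 + x ^ 4))⁻¹ := by
    rw [agmIntegral, integral_eq_integral_Ioi_half_sub_div one_pos, ← integral_const_mul]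
    refine setIntegral_congr_fun measurableSet_Ioi fun x hx ↦ ?_
    rw [mem_Ioi] at hx
    have e : (((x - 1 / x) / 2) ^ 2 + 1 ^ 2) * (((x - 1 / x) / 2) ^ 2 + (√2)⁻¹ ^ 2) =
        ((x ^ 2 + 1) / (4 * x ^ 2)) ^ 2 * (1 + x ^ 4) := by
      rw [inv_pow, Real.sq_sqrt two_pos.le]
      field_simp
      ring
    rw [e, Real.sqrt_mul (by positivity), Real.sqrt_sq (by positivity), mul_inv]
    field_simp
    ring
  have h := integral_inv_sqrt_one_add_pow_four
  rw [this, ← div_div, div_right_comm, ← h]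
  ring

/-- Homogeneity reduces `agmIntegral_theta` to `agmIntegral 1 (1/√2) = π θ₃(1)²`; the reflection
formula then trades `Γ(1/4)` for `Γ(3/4)`. -/
lemma thetaThree_one : thetaThree 1 = Real.pi ^ (1 / 4 : ℝ) / Real.Gamma (3 / 4) := by
  have hA : 0 < thetaThree 1 := one_pos.trans_le (one_le_thetaThree one_pos)
  have hB : thetaFour 1 ^ 2 = thetaThree 1 ^ 2 * (√2)⁻¹ := by
    refine (pow_left_inj₀ (by positivity) (by positivity) two_ne_zero).mp ?_
    rw [mul_pow, inv_pow, Real.sq_sqrt two_pos.le]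
    linear_combination two_mul_thetaFour_one_pow_four / 2
  have h := agmIntegral_theta
  rw [hB] at h
  nth_rewrite 1 [← mul_one (thetaThree 1 ^ 2)] at h
  rw [agmIntegral_mul (by positivity), agmIntegral_one_inv_sqrt_two] at h
  have hG : Real.Gamma (1 / 4) * Real.Gamma (3 / 4) = Real.pi * √2 := by
    have := Real.Gamma_mul_Gamma_one_sub (1 / 4)
    rw [show (1 - 1 / 4 : ℝ) = 3 / 4 by norm_num, show Real.pi * (1 / 4) = Real.pi / 4 by ring,
      Real.sin_pi_div_four] at this
    rw [this]
    field_simp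
    rw [Real.sq_sqrt two_pos.le]
  have hG3 : 0 < Real.Gamma (3 / 4) := Real.Gamma_pos_of_pos (by norm_num)
  have hG2 : Real.Gamma (1 / 4) ^ 2 * Real.Gamma (3 / 4) ^ 2 = 2 * Real.pi ^ 2 := by
    rw [← mul_pow, hG, mul_pow, Real.sq_sqrt two_pos.le]
    ring
  have hs : √Real.pi ^ 2 = Real.pi := Real.sq_sqrt Real.pi_pos.le
  have hs0 : 0 < √Real.pi := Real.sqrt_pos.mpr Real.pi_pos
  have hq : (Real.pi ^ (1 / 4 : ℝ)) ^ 2 = √Real.pi := by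
    rw [← Real.rpow_natCast, ← Real.rpow_mul Real.pi_pos.le, Real.sqrt_eq_rpow]
    norm_num
  refine (pow_left_inj₀ hA.le (by positivity) two_ne_zero).mp ?_
  rw [div_pow, hq, eq_div_iff (by positivity)]
  field_simp at h
  have : Real.pi * √Real.pi * (thetaThree 1 ^ 2 * Real.Gamma (3 / 4) ^ 2 - √Real.pi) = 0 := by
    linear_combination (-Real.Gamma (3 / 4) ^ 2 / 2) * h + hG2 / 2 - Real.pi * hs
  rcases mul_eq_zero.mp this with h' | h'
  · exact absurd h' (by positivity)
  · linarith

/-! ### Decay of the completed zeta function on the edges of the strip. -/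

/-- By Abel summation the difference is `-s ∫₁^∞ {t} t^(-s-1) dt`, and the integral is at most `1/Re
s ≤ 1`. The bound does not degenerate as `Re s → 1`, so it passes to the line `Re s = 1` by
continuity. -/
lemma norm_riemannZeta_sub_le {s : ℂ} (hs : 1 < s.re) : ‖riemannZeta s - s / (s - 1)‖ ≤ ‖s‖ := by
  have h1 : riemannZeta s =
      s * ∫ t in Ioi (1 : ℝ), (⌊t⌋₊ : ℂ) * (t : ℂ) ^ (-(s + 1)) := by
    have h := LSeries_eq_mul_integral (1 : ℕ → ℂ) zero_le_one hs
      (LSeriesSummable_one_iff.mpr hs) (by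
        refine IsBigO.of_bound 1 (Eventually.of_forall fun n ↦ ?_)
        simp)
    rw [LSeries_one_eq_riemannZeta hs] at h
    simpa using h
  have h2 : s / (s - 1) = s * ∫ t in Ioi (1 : ℝ), (t : ℂ) ^ (-s) := by
    rw [integral_Ioi_cpow_of_lt (by simpa using hs) one_pos]
    simp only [Complex.ofReal_one, Complex.one_cpow]
    rw [show -s + 1 = -(s - 1) by ring, neg_div_neg_eq, mul_one_div]
  have i2 : IntegrableOn (fun t : ℝ ↦ (t : ℂ) ^ (-s)) (Ioi 1) :=
    integrableOn_Ioi_cpow_of_lt (by simpa using hs) one_pos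
  have hpow (t : ℝ) (ht : 0 < t) : (t : ℂ) * (t : ℂ) ^ (-(s + 1)) = (t : ℂ) ^ (-s) := by
    have ht' : (t : ℂ) ≠ 0 := Complex.ofReal_ne_zero.mpr ht.ne'
    rw [show -s = 1 + -(s + 1) by ring, Complex.cpow_add _ _ ht', Complex.cpow_one]
  have i1 : IntegrableOn (fun t : ℝ ↦ (⌊t⌋₊ : ℂ) * (t : ℂ) ^ (-(s + 1))) (Ioi 1) := by
    refine Integrable.mono' (g := fun t ↦ ‖(t : ℂ) ^ (-s)‖) i2.norm
      (Measurable.aestronglyMeasurable (by fun_prop)) ?_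
    refine (ae_restrict_iff' measurableSet_Ioi).mpr (ae_of_all _ fun t ht ↦ ?_)
    have ht0 : 0 < t := one_pos.trans ht
    rw [← hpow t ht0, norm_mul, norm_mul, Complex.norm_natCast, Complex.norm_of_nonneg ht0.le]
    gcongr
    exact Nat.floor_le ht0.le
  have hre : 0 < s.re := one_pos.trans hs
  have i3 : IntegrableOn (fun t : ℝ ↦ t ^ (-(s.re + 1))) (Ioi 1) :=
    integrableOn_Ioi_rpow_of_lt (by linarith) one_pos
  rw [h1, h2, ← mul_sub, ← integral_sub i1 i2, norm_mul]
  refine mul_le_of_le_one_right (norm_nonneg _) ?_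
  calc _ ≤ ∫ t in Ioi (1 : ℝ), t ^ (-(s.re + 1)) := by
        refine norm_integral_le_of_norm_le i3
          ((ae_restrict_iff' measurableSet_Ioi).mpr (ae_of_all _ fun t ht ↦ ?_))
        have ht0 : 0 < t := one_pos.trans ht
        rw [← hpow t ht0, ← sub_mul, norm_mul, Complex.norm_cpow_eq_rpow_re_of_pos ht0]
        simp only [Complex.neg_re, Complex.add_re, Complex.one_re]
        refine mul_le_of_le_one_left (by positivity) ?_
        rw [← Complex.ofReal_natCast, ← Complex.ofReal_sub, Complex.norm_real, Real.norm_eq_abs,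
          abs_le]
        constructor <;> linarith [Nat.floor_le ht0.le, Nat.lt_floor_add_one t]
    _ = 1 / s.re := by
        rw [integral_Ioi_rpow_of_lt (by linarith) one_pos, Real.one_rpow,
          show -(s.re + 1) + 1 = -s.re by ring, neg_div_neg_eq]
    _ ≤ 1 := (div_le_one hre).mpr hs.le

lemma norm_riemannZeta_one_add_mul_I_le {y : ℝ} (hy : y ≠ 0) :
    ‖riemannZeta (1 + y * Complex.I) - (1 + y * Complex.I) / (y * Complex.I)‖ ≤
      ‖1 + y * Complex.I‖ := by
  have hc : Continuous fun δ : ℝ ↦ 1 + y * Complex.I + δ := by fun_prop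
  have h0 : Tendsto (fun δ : ℝ ↦ 1 + y * Complex.I + δ) (𝓝[>] 0) (𝓝 (1 + y * Complex.I)) :=
    (hc.tendsto' 0 _ (by simp)).mono_left nhdsWithin_le_nhds
  have hz := (differentiableAt_riemannZeta (s := 1 + y * Complex.I)
    (by simpa using hy)).continuousAt.tendsto.comp h0
  have hq : Tendsto (fun δ : ℝ ↦ (1 + y * Complex.I + δ) / (1 + y * Complex.I + δ - 1)) (𝓝[>] 0)
      (𝓝 ((1 + y * Complex.I) / (y * Complex.I))) := by
    have := h0.div (h0.sub_const 1) (by simpa using hy)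
    rwa [add_sub_cancel_left] at this
  refine le_of_tendsto_of_tendsto (hz.sub hq).norm h0.norm ?_
  filter_upwards [self_mem_nhdsWithin] with δ hδ
  exact norm_riemannZeta_sub_le (by simpa using hδ)

lemma norm_riemannZeta_one_add_mul_I_mul_le {y : ℝ} (hy : y ≠ 0) :
    |y| * ‖riemannZeta (1 + y * Complex.I)‖ ≤ (1 + |y|) ^ 2 := by
  have h := norm_riemannZeta_one_add_mul_I_le hy
  have h1 : ‖1 + y * Complex.I‖ ≤ 1 + |y| := by
    simpa using norm_add_le (1 : ℂ) (y * Complex.I)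
  have h2 := norm_sub_norm_le (riemannZeta (1 + y * Complex.I))
    ((1 + y * Complex.I) / (y * Complex.I))
  have hy0 : 0 < |y| := abs_pos.mpr hy
  rw [norm_div, norm_mul, Complex.norm_I, Complex.norm_real, Real.norm_eq_abs, mul_one] at h2
  have h3 : ‖riemannZeta (1 + y * Complex.I)‖ ≤ (1 + |y|) + (1 + |y|) / |y| := by
    have : ‖1 + y * Complex.I‖ / |y| ≤ (1 + |y|) / |y| := by gcongr
    linarith
  calc _ ≤ |y| * ((1 + |y|) + (1 + |y|) / |y|) := by gcongr
    _ = _ := by field_simp; ring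

/-- Reflection formula: on `Re z = 1/2` the point `1 - z` is the conjugate of `z`. -/
lemma norm_Gamma_half_add_mul_I_sq (y : ℝ) :
    ‖Complex.Gamma (1 / 2 + y * Complex.I)‖ ^ 2 = Real.pi / Real.cosh (Real.pi * y) := by
  have h := Complex.Gamma_mul_Gamma_one_sub (1 / 2 + y * Complex.I)
  have hc : 1 - (1 / 2 + y * Complex.I) = (starRingEnd ℂ) (1 / 2 + y * Complex.I) := by
    simp only [map_add, map_mul, Complex.conj_ofReal, Complex.conj_I, map_div₀, map_one, map_ofNat]
    ring
  rw [hc, Complex.Gamma_conj, Complex.mul_conj, Complex.normSq_eq_norm_sq,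
    show (Real.pi : ℂ) * (1 / 2 + y * Complex.I) = (Real.pi * y : ℝ) * Complex.I + Real.pi / 2 by
      push_cast; ring, Complex.sin_add_pi_div_two, Complex.cos_mul_I, ← Complex.ofReal_cosh] at h
  exact_mod_cast h

lemma norm_Gamma_half_add_mul_I_le (y : ℝ) :
    ‖Complex.Gamma (1 / 2 + y * Complex.I)‖ ≤ √Real.pi * (2 * Real.exp (-|y|)) := by
  refine le_of_sq_le_sq ?_ (by positivity)
  rw [norm_Gamma_half_add_mul_I_sq, mul_pow, Real.sq_sqrt Real.pi_pos.le, div_eq_mul_inv]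
  have h1 : Real.exp (2 * |y|) / 2 ≤ Real.cosh (Real.pi * y) := by
    rw [← Real.cosh_abs, abs_mul, abs_of_pos Real.pi_pos, Real.cosh_eq]
    have : Real.exp (2 * |y|) ≤ Real.exp (Real.pi * |y|) := by
      gcongr
      exact Real.two_le_pi
    have := Real.exp_pos (-(Real.pi * |y|))
    linarith
  refine mul_le_mul_of_nonneg_left ?_ Real.pi_pos.le
  calc _ ≤ (Real.exp (2 * |y|) / 2)⁻¹ := by gcongr
    _ = 2 * Real.exp (-|y|) ^ 2 := by
      rw [inv_div, ← Real.exp_nat_mul, div_eq_mul_inv, ← Real.exp_neg]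
      push_cast
      ring_nf
    _ ≤ (2 * Real.exp (-|y|)) ^ 2 := by nlinarith [sq_nonneg (Real.exp (-|y|))]

/-- Exponential decay of the completed zeta function on the line `Re s = 1`. -/
lemma norm_completedRiemannZeta_one_add_mul_I_le {v : ℝ} (hv : v ≠ 0) :
    |v| * ‖completedRiemannZeta (1 + 2 * v * Complex.I)‖ ≤ (1 + 2 * |v|) ^ 2 * Real.exp (-|v|) := by
  have hs0 : (1 : ℂ) + 2 * v * Complex.I ≠ 0 := fun h ↦ by simpa using congrArg Complex.re h
  have h := riemannZeta_def_of_ne_zero hs0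
  have hG : Complex.Gammaℝ (1 + 2 * v * Complex.I) ≠ 0 :=
    Complex.Gammaℝ_ne_zero_of_re_pos (by simp)
  rw [eq_div_iff hG] at h
  have h1 : ‖Complex.Gammaℝ (1 + 2 * v * Complex.I)‖ ≤ 2 * Real.exp (-|v|) := by
    rw [Complex.Gammaℝ_def, norm_mul, Complex.norm_cpow_eq_rpow_re_of_pos Real.pi_pos,
      show (1 + 2 * v * Complex.I) / 2 = 1 / 2 + v * Complex.I by ring]
    have : (-(1 + 2 * v * Complex.I) / 2).re = -(1 / 2) := by
      simp; norm_num
    rw [this, Real.rpow_neg Real.pi_pos.le, ← Real.sqrt_eq_rpow]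
    have h0 : 0 < √Real.pi := Real.sqrt_pos.mpr Real.pi_pos
    rw [inv_mul_le_iff₀ h0]
    exact norm_Gamma_half_add_mul_I_le v
  have h2 := norm_riemannZeta_one_add_mul_I_mul_le (y := 2 * v) (by simpa using hv)
  push_cast at h2
  rw [abs_mul, abs_two] at h2
  rw [← h, norm_mul]
  calc _ = (2 * |v| * ‖riemannZeta (1 + 2 * v * Complex.I)‖) / 2 *
        ‖Complex.Gammaℝ (1 + 2 * v * Complex.I)‖ := by ring
    _ ≤ (1 + 2 * |v|) ^ 2 / 2 * (2 * Real.exp (-|v|)) := by gcongr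
    _ = _ := by ring

/-- Exponential decay of the completed zeta function on the line `Re s = 0`. -/
lemma norm_completedRiemannZeta_mul_I_le {v : ℝ} (hv : v ≠ 0) :
    |v| * ‖completedRiemannZeta (2 * Complex.I * v)‖ ≤ (1 + 2 * |v|) ^ 2 * Real.exp (-|v|) := by
  have := norm_completedRiemannZeta_one_add_mul_I_le (neg_ne_zero.mpr hv)
  rw [← completedRiemannZeta_one_sub, show 1 - 2 * Complex.I * v =
    1 + 2 * (-v : ℝ) * Complex.I by push_cast; ring]
  simpa using this

/-! ### Integrability on the line `Re w = 0`. -/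

lemma MeasureTheory.IntegrableOn.comp_abs {f : ℝ → ℝ} (hf : IntegrableOn f (Ioi 0)) :
    Integrable fun x ↦ f |x| := by
  have hf' : IntegrableOn (fun x ↦ f |x|) (Ioi 0) :=
    hf.congr_fun (fun x hx ↦ by rw [abs_of_pos hx]) measurableSet_Ioi
  have int_Iic : IntegrableOn (fun x ↦ f |x|) (Iic 0) := by
    rw [← Measure.map_neg_eq_self (volume : Measure ℝ)]
    let m : MeasurableEmbedding fun x : ℝ => -x := (Homeomorph.neg ℝ).measurableEmbedding
    rw [m.integrableOn_map_iff]
    simp_rw [Function.comp_def, abs_neg, neg_preimage, neg_Iic, neg_zero]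
    exact Iff.mpr integrableOn_Ici_iff_integrableOn_Ioi hf'
  rw [← integrableOn_univ, ← Iic_union_Ioi (a := (0 : ℝ))]
  exact int_Iic.union hf'

lemma integrable_pow_mul_exp_neg_abs (n : ℕ) :
    Integrable fun v : ℝ ↦ (1 + 2 * |v|) ^ n * Real.exp (-|v|) := by
  have h : IntegrableOn (fun v : ℝ ↦ (1 + 2 * v) ^ n * Real.exp (-v)) (Ioi 0) := by
    refine integrable_of_isBigO_exp_neg (b := 1 / 2) (by norm_num) (by fun_prop) ?_
    have h1 : (fun v : ℝ ↦ (1 + 2 * v) ^ n) =O[atTop] fun v ↦ Real.exp (1 / 2 * v) := by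
      have h2 : (fun v : ℝ ↦ (1 + 2 * v) ^ n) =O[atTop] fun v ↦ v ^ n := by
        refine IsBigO.pow ?_ n
        refine IsBigO.of_bound 3 ?_
        filter_upwards [eventually_ge_atTop 1] with v hv
        rw [Real.norm_of_nonneg (by linarith), Real.norm_of_nonneg (by linarith)]
        linarith
      exact h2.trans (isLittleO_pow_exp_pos_mul_atTop n (by norm_num)).isBigO
    refine (h1.mul (isBigO_refl (fun v : ℝ ↦ Real.exp (-v)) atTop)).congr_right fun v ↦ ?_
    rw [← Real.exp_add]
    ring_nf
  exact h.comp_abs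

lemma upsilonFn_two_mul_I {v : ℝ} (hv : v ≠ 0) :
    upsilonFn (2 * Complex.I * v) = completedRiemannZeta (2 * Complex.I * v) := by
  have hw : 2 * Complex.I * v ≠ 0 := by simp [hv]
  have hG : Complex.Gammaℝ (2 * Complex.I * v) ≠ 0 := by
    rw [Ne, Complex.Gammaℝ_eq_zero_iff]
    rintro ⟨n, hn⟩
    have := congrArg Complex.im hn
    simp [hv] at this
  rw [upsilonFn, riemannZeta_def_of_ne_zero hw, mul_assoc,
    show Complex.Gamma (2 * Complex.I * v / 2) * (Real.pi : ℂ) ^ (-(2 * Complex.I * v) / 2) =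
      Complex.Gammaℝ (2 * Complex.I * v) by rw [Complex.Gammaℝ_def, mul_comm],
    div_mul_cancel₀ _ hG]

lemma measurable_completedRiemannZeta : Measurable completedRiemannZeta := by
  rw [show completedRiemannZeta = _ from funext completedRiemannZeta_eq]
  have := differentiable_completedZeta₀.continuous.measurable
  fun_prop

/-- The factor `v` makes the values assigned to the two sides at the pole `v = 0` irrelevant. -/
lemma upsilonFn_two_mul_I_mul (v : ℝ) :
    upsilonFn (2 * Complex.I * v) * v = completedRiemannZeta (2 * Complex.I * v) * v := by
  rcases eq_or_ne v 0 with rfl | hv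
  · simp
  · rw [upsilonFn_two_mul_I hv]

lemma norm_upsilonFn_mul_le (v : ℝ) :
    ‖upsilonFn (2 * Complex.I * v) * v‖ ≤ (1 + 2 * |v|) ^ 2 * Real.exp (-|v|) := by
  rcases eq_or_ne v 0 with rfl | hv
  · simp
  · rw [upsilonFn_two_mul_I hv, norm_mul, Complex.norm_real, mul_comm]
    exact norm_completedRiemannZeta_mul_I_le hv

lemma measurable_upsilonFn_mul :
    Measurable fun v : ℝ ↦ upsilonFn (2 * Complex.I * v) * v := by
  simp_rw [upsilonFn_two_mul_I_mul]
  have := measurable_completedRiemannZeta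
  fun_prop

/-- Linear growth of `g` is allowed because the later limit `t → ∞` uses a bound on the transfer
function that is uniform in `t` but grows with `v`. -/
lemma norm_mul_upsilonFn_le {g : ℝ → ℂ} {C : ℝ} (hC : ∀ v, ‖g v‖ ≤ C * (1 + 2 * |v|)) (v : ℝ) :
    ‖g v * (upsilonFn (2 * Complex.I * v) * v)‖ ≤ C * ((1 + 2 * |v|) ^ 3 * Real.exp (-|v|)) := by
  rw [norm_mul]
  calc _ ≤ (C * (1 + 2 * |v|)) * ((1 + 2 * |v|) ^ 2 * Real.exp (-|v|)) := by
        gcongr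
        · exact (norm_nonneg _).trans (hC v)
        · exact hC v
        · exact norm_upsilonFn_mul_le v
    _ = _ := by ring

lemma integrable_mul_upsilonFn {g : ℝ → ℂ} (hg : Measurable g) {C : ℝ}
    (hC : ∀ v, ‖g v‖ ≤ C * (1 + 2 * |v|)) :
    Integrable fun v : ℝ ↦ g v * (upsilonFn (2 * Complex.I * v) * v) :=
  ((integrable_pow_mul_exp_neg_abs 3).const_mul C).mono'
    (hg.mul measurable_upsilonFn_mul).aestronglyMeasurable
    (ae_of_all _ (norm_mul_upsilonFn_le hC))

lemma completedRiemannZeta₀_eq {w : ℂ} (hw : w ≠ 0) (hw1 : 1 - w ≠ 0) :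
    completedRiemannZeta₀ w = completedRiemannZeta w + 1 / (w * (1 - w)) := by
  rw [completedRiemannZeta_eq]
  field_simp
  ring

/-- Continuity controls `|v| ≤ 1`. Beyond that, `Λ` decays exponentially and the pole part `1/(w(1 -
w))` quadratically. -/
lemma integrable_completedRiemannZeta₀ :
    Integrable fun v : ℝ ↦ completedRiemannZeta₀ (2 * Complex.I * v) := by
  have hc : Continuous fun v : ℝ ↦ completedRiemannZeta₀ (2 * Complex.I * v) :=
    differentiable_completedZeta₀.continuous.comp (by fun_prop)
  obtain ⟨C, hC⟩ := (isCompact_Icc (a := (-1 : ℝ)) (b := 1)).exists_bound_of_continuousOn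
    hc.continuousOn
  have hC0 : 0 ≤ C := (norm_nonneg _).trans (hC 0 (by simp))
  refine Integrable.mono' (g := fun v ↦ (2 * C + 1) * (1 + v ^ 2)⁻¹ +
    (1 + 2 * |v|) ^ 2 * Real.exp (-|v|))
    ((integrable_inv_one_add_sq.const_mul _).add (integrable_pow_mul_exp_neg_abs 2))
    hc.aestronglyMeasurable (ae_of_all _ fun v ↦ ?_)
  have hinv : 0 < (1 + v ^ 2)⁻¹ := by positivity
  have hexp : 0 ≤ (1 + 2 * |v|) ^ 2 * Real.exp (-|v|) := by positivity
  rcases le_or_gt |v| 1 with h | h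
  · have h1 := hC v (abs_le.mp h)
    have h2 : (1 / 2 : ℝ) ≤ (1 + v ^ 2)⁻¹ := by
      rw [one_div]
      gcongr
      nlinarith [sq_abs v, abs_nonneg v]
    nlinarith
  · have hv : v ≠ 0 := fun h0 ↦ by simp [h0] at h; linarith
    have hw : 2 * Complex.I * v ≠ 0 := by simp [hv]
    have hw1 : 1 - 2 * Complex.I * v ≠ 0 := fun h0 ↦ by simpa using congrArg Complex.re h0
    have e : completedRiemannZeta₀ (2 * Complex.I * v) =
        completedRiemannZeta (2 * Complex.I * v) +
          1 / (2 * Complex.I * v * (1 - 2 * Complex.I * v)) :=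
      completedRiemannZeta₀_eq hw hw1
    have h1 := norm_completedRiemannZeta_mul_I_le hv
    have h2 : ‖completedRiemannZeta (2 * Complex.I * v)‖ ≤
        |v| * ‖completedRiemannZeta (2 * Complex.I * v)‖ :=
      le_mul_of_one_le_left (norm_nonneg _) h.le
    have h3 : |v| ≤ ‖1 - 2 * Complex.I * v‖ := by
      have := Complex.abs_im_le_norm (1 - 2 * Complex.I * v)
      simp [abs_mul] at this
      linarith [abs_nonneg v]
    have h4 : ‖1 / (2 * Complex.I * v * (1 - 2 * Complex.I * v))‖ ≤ (1 + v ^ 2)⁻¹ := by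
      rw [norm_div, norm_one, one_div, norm_mul]
      gcongr
      simp only [norm_mul, Complex.norm_I, Complex.norm_real, Real.norm_eq_abs, Complex.norm_ofNat]
      nlinarith [sq_abs v, abs_nonneg v]
    rw [e]
    refine (norm_add_le _ _).trans ?_
    nlinarith

/-! ### Mellin inversion and the Cauchy transform of `Λ₀`. -/

/-- The function `θ₃(x) - max 1 x^(-1/2)`, whose Mellin transform is entire. -/
noncomputable def thetaCut (x : ℝ) : ℂ := ((thetaThree x - max 1 (√x)⁻¹ : ℝ) : ℂ)

/-- `f_modif` is set to zero at `x = 1`, whereas `thetaCut` is continuous there. Continuity at `1`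
is what lets Mellin inversion produce `θ₃(1)`. -/
lemma thetaCut_eq_f_modif {x : ℝ} (hx : 0 < x) (hx1 : x ≠ 1) :
    thetaCut x = (HurwitzZeta.hurwitzEvenFEPair 0).f_modif x := by
  have hk : x ^ (-(1 / 2) : ℝ) = (√x)⁻¹ := by rw [Real.rpow_neg hx.le, ← Real.sqrt_eq_rpow]
  have hs : 0 < √x := Real.sqrt_pos.mpr hx
  rcases lt_or_gt_of_ne hx1 with h | h
  · have hm : max 1 (√x)⁻¹ = (√x)⁻¹ :=
      max_eq_right ((one_le_inv₀ hs).mpr (Real.sqrt_le_one.mpr h.le))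
    rw [thetaCut, hm, thetaThree_eq_evenKernel hx, ← hk]
    simp [WeakFEPair.f_modif, HurwitzZeta.hurwitzEvenFEPair, h, hx, h.le]
  · have hm : max 1 (√x)⁻¹ = 1 :=
      max_eq_left (inv_le_one_of_one_le₀ (Real.one_le_sqrt.mpr h.le))
    rw [thetaCut, hm, thetaThree_eq_evenKernel hx]
    simp [WeakFEPair.f_modif, HurwitzZeta.hurwitzEvenFEPair, h, h.le]

lemma thetaCut_ae_eq (s : ℂ) :
    (fun t : ℝ ↦ (t : ℂ) ^ (s - 1) • thetaCut t) =ᵐ[volume.restrict (Ioi 0)]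
      fun t : ℝ ↦ (t : ℂ) ^ (s - 1) • (HurwitzZeta.hurwitzEvenFEPair 0).f_modif t := by
  refine (ae_restrict_iff' measurableSet_Ioi).mpr ?_
  filter_upwards [compl_mem_ae_iff.mpr (measure_singleton (1 : ℝ))] with t h1 ht
  rw [thetaCut_eq_f_modif ht h1]

lemma mellinConvergent_thetaCut (s : ℂ) : MellinConvergent thetaCut s :=
  Integrable.congr ((WeakFEPair.isStrongFEPair_toStrongFEPair
    (HurwitzZeta.hurwitzEvenFEPair 0)).hasMellin s).1 (thetaCut_ae_eq s).symm

lemma mellin_thetaCut (s : ℂ) : mellin thetaCut s = 2 * completedRiemannZeta₀ (2 * s) := by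
  have h : completedRiemannZeta₀ (2 * s) =
      mellin (HurwitzZeta.hurwitzEvenFEPair 0).f_modif (2 * s / 2) / 2 := rfl
  rw [h, mul_div_cancel_left₀ _ two_ne_zero, mul_div_cancel₀ _ two_ne_zero]
  exact integral_congr_ae (thetaCut_ae_eq s)

lemma continuousAt_thetaCut {x : ℝ} (hx : 0 < x) : ContinuousAt thetaCut x := by
  have h1 : ContinuousAt thetaThree x :=
    ((HurwitzZeta.continuousOn_evenKernel 0).continuousAt (Ioi_mem_nhds hx)).congr (by
      filter_upwards [Ioi_mem_nhds hx] with y hy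
      exact (thetaThree_eq_evenKernel hy).symm)
  refine Complex.continuous_ofReal.continuousAt.comp (h1.sub (continuousAt_const.max ?_))
  exact Real.continuous_sqrt.continuousAt.inv₀ (Real.sqrt_pos.mpr hx).ne'

lemma thetaCut_inv {x : ℝ} (hx : 0 < x) : thetaCut x⁻¹ = (√x : ℝ) * thetaCut x := by
  have hs : 0 < √x := Real.sqrt_pos.mpr hx
  rw [thetaCut, thetaCut, ← Complex.ofReal_mul, thetaThree_inv hx, Real.sqrt_inv, inv_inv, mul_sub,
    mul_max_of_nonneg _ _ hs.le, mul_one, mul_inv_cancel₀ hs.ne', max_comm]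

/-- Mellin inversion on the line `Re s = 0`. -/
lemma integral_cpow_mul_completedRiemannZeta₀ {x : ℝ} (hx : 0 < x) :
    ∫ v : ℝ, (x : ℂ) ^ (-(v * Complex.I)) * completedRiemannZeta₀ (2 * Complex.I * v) =
      Real.pi * thetaCut x := by
  have hm (v : ℝ) : mellin thetaCut (v * Complex.I) =
      2 * completedRiemannZeta₀ (2 * Complex.I * v) := by
    rw [mellin_thetaCut]
    ring_nf
  have h := mellinInv_mellin_eq 0 thetaCut hx (mellinConvergent_thetaCut _) (by
    unfold Complex.VerticalIntegrable
    simpa [hm] using integrable_completedRiemannZeta₀.const_mul 2) (continuousAt_thetaCut hx)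
  unfold mellinInv at h
  simp only [Complex.ofReal_zero, zero_add, hm, smul_eq_mul, mul_left_comm _ (2 : ℂ)] at h
  rw [integral_const_mul] at h
  rw [← h]
  simp only [Complex.real_smul]
  push_cast
  have : (Real.pi : ℂ) ≠ 0 := by exact_mod_cast Real.pi_ne_zero
  rw [one_div, mul_left_comm, mul_inv, mul_assoc, inv_mul_cancel_left₀ this,
    inv_mul_cancel_left₀ two_ne_zero]

/-- For `Re s > 0`, `1/(2iv - s) = -½ ∫₀¹ x^(s/2 - 1) x^(-iv) dx`; after Fubini the inner integral
over `v` is Mellin inversion. -/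
lemma integral_completedRiemannZeta₀_mul_inv_sub {s : ℂ} (hs : 0 < s.re) :
    ∫ v : ℝ, completedRiemannZeta₀ (2 * Complex.I * v) * (2 * Complex.I * v - s)⁻¹ =
      -(Real.pi / 2) * ∫ x in Ioc (0 : ℝ) 1, (x : ℂ) ^ (s / 2 - 1) * thetaCut x := by
  have hre (v : ℝ) : 0 < (s / 2 - v * Complex.I).re := by simpa using hs
  have hinv (v : ℝ) : (2 * Complex.I * v - s)⁻¹ =
      -(1 / 2) * ∫ x in Ioc (0 : ℝ) 1, (x : ℂ) ^ (s / 2 - 1) * (x : ℂ) ^ (-(v * Complex.I)) := by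
    have hne : s / 2 - v * Complex.I ≠ 0 := fun h ↦ by
      have := hre v
      rw [h] at this
      simp at this
    have h1 : ∫ x in Ioc (0 : ℝ) 1, (x : ℂ) ^ (s / 2 - 1) * (x : ℂ) ^ (-(v * Complex.I)) =
        ∫ x in Ioc (0 : ℝ) 1, (x : ℂ) ^ (s / 2 - v * Complex.I - 1) := by
      refine setIntegral_congr_fun measurableSet_Ioc fun x hx ↦ ?_
      rw [← Complex.cpow_add _ _ (Complex.ofReal_ne_zero.mpr hx.1.ne')]
      ring_nf
    rw [h1, ← intervalIntegral.integral_of_le zero_le_one, integral_cpow (Or.inl (by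
      simpa using hs)), sub_add_cancel, Complex.ofReal_one, Complex.one_cpow, Complex.ofReal_zero,
      Complex.zero_cpow hne, sub_zero]
    have hne' : 2 * Complex.I * v - s ≠ 0 := fun h ↦ hne (by linear_combination -h / 2)
    rw [show s / 2 - v * Complex.I = -(2 * Complex.I * v - s) / 2 by ring]
    field_simp
  have hprod : Integrable (fun p : ℝ × ℝ ↦ completedRiemannZeta₀ (2 * Complex.I * p.1) *
      ((p.2 : ℂ) ^ (s / 2 - 1) * (p.2 : ℂ) ^ (-(p.1 * Complex.I))))
      (volume.prod (volume.restrict (Ioc 0 1))) := by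
    have i2 : Integrable (fun x : ℝ ↦ (x : ℂ) ^ (s / 2 - 1)) (volume.restrict (Ioc 0 1)) := by
      have := intervalIntegral.intervalIntegrable_cpow' (a := 0) (b := 1) (r := s / 2 - 1)
        (by simpa using hs)
      rwa [intervalIntegrable_iff_integrableOn_Ioc_of_le zero_le_one] at this
    -- Since `|x^(-iv)| = 1`, the integrand has the norm of a product of two integrable functions.
    refine (integrable_completedRiemannZeta₀.mul_prod i2).mono ?_ ?_
    · have := differentiable_completedZeta₀.continuous.measurable
      exact Measurable.aestronglyMeasurable (by fun_prop)
    · have hpos : ∀ᵐ p : ℝ × ℝ ∂(volume.prod (volume.restrict (Ioc 0 1))), 0 < p.2 :=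
        Measure.quasiMeasurePreserving_snd.ae
          ((ae_restrict_iff' measurableSet_Ioc).mpr (ae_of_all _ fun x hx ↦ hx.1))
      filter_upwards [hpos] with p hp
      rw [← mul_assoc, norm_mul, Complex.norm_cpow_eq_rpow_re_of_pos hp]
      simp
  calc _ = ∫ v : ℝ, -(1 / 2) * ∫ x in Ioc (0 : ℝ) 1, completedRiemannZeta₀ (2 * Complex.I * v) *
        ((x : ℂ) ^ (s / 2 - 1) * (x : ℂ) ^ (-(v * Complex.I))) := by
        congr 1
        ext v
        rw [hinv, integral_const_mul]
        ring
    _ = -(1 / 2) * ∫ x in Ioc (0 : ℝ) 1, ∫ v : ℝ, completedRiemannZeta₀ (2 * Complex.I * v) *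
        ((x : ℂ) ^ (s / 2 - 1) * (x : ℂ) ^ (-(v * Complex.I))) := by
        rw [integral_const_mul, integral_integral_swap hprod]
    _ = -(1 / 2) * ∫ x in Ioc (0 : ℝ) 1, Real.pi * ((x : ℂ) ^ (s / 2 - 1) * thetaCut x) := by
        congr 1
        refine setIntegral_congr_fun measurableSet_Ioc fun x hx ↦ ?_
        rw [mul_left_comm (Real.pi : ℂ), ← integral_cpow_mul_completedRiemannZeta₀ hx.1,
          ← integral_const_mul]
        congr 1
        ext v
        ring
    _ = _ := by
        rw [integral_const_mul]
        ring

/-- Substituting `x ↦ 1/x` and using `thetaCut_inv`: the half for `1 - s` over `(0, 1]` is the half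
for `s` over `(1, ∞)` missing from the Mellin integral. -/
lemma integral_Ioc_thetaCut_one_sub (s : ℂ) :
    ∫ x in Ioc (0 : ℝ) 1, (x : ℂ) ^ ((1 - s) / 2 - 1) * thetaCut x =
      ∫ x in Ioi (1 : ℝ), (x : ℂ) ^ (s / 2 - 1) * thetaCut x := by
  have h1 (f : ℝ → ℂ) (z : ℂ) (A : Set ℝ) (hA : MeasurableSet A) (hA0 : A ⊆ Ioi 0) :
      ∫ x in A, (x : ℂ) ^ (z - 1) * f x = mellin (A.indicator f) z := by
    rw [mellin, ← integral_indicator hA, ← integral_indicator measurableSet_Ioi]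
    congr 1
    ext x
    by_cases hx : x ∈ A
    · simp [hx, mem_Ioi.mp (hA0 hx)]
    · simp [hx, indicator]
  rw [h1 _ _ _ measurableSet_Ioc Ioc_subset_Ioi_self, ← neg_neg ((1 - s) / 2), ← mellin_comp_inv,
    ← integral_Ici_eq_integral_Ioi, h1 _ _ _ measurableSet_Ici (Ici_subset_Ioi.mpr one_pos),
    show s / 2 = -((1 - s) / 2) + 1 / 2 by ring, ← mellin_cpow_smul]
  refine setIntegral_congr_fun measurableSet_Ioi fun x hx ↦ ?_
  rw [mem_Ioi] at hx
  have hsq : ((√x : ℝ) : ℂ) = (x : ℂ) ^ (1 / 2 : ℂ) := by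
    rw [Real.sqrt_eq_rpow, Complex.ofReal_cpow hx.le]
    push_cast
    rfl
  have hiff : x⁻¹ ∈ Ioc (0 : ℝ) 1 ↔ x ∈ Ici (1 : ℝ) := by
    rw [mem_Ioc, mem_Ici, inv_le_one₀ hx]
    exact and_iff_right (inv_pos.mpr hx)
  by_cases h : x ∈ Ici (1 : ℝ)
  · beta_reduce
    rw [indicator_of_mem (hiff.mpr h), indicator_of_mem h, thetaCut_inv hx, hsq,
      smul_eq_mul (_ ^ _) (thetaCut x)]
  · beta_reduce
    rw [indicator_of_notMem (fun h' ↦ h (hiff.mp h')), indicator_of_notMem h, smul_zero,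
      smul_zero, smul_zero]

lemma integral_completedRiemannZeta₀_mul_inv_add_inv {s : ℂ} (h0 : 0 < s.re) (h1 : s.re < 1) :
    (∫ v : ℝ, completedRiemannZeta₀ (2 * Complex.I * v) * (2 * Complex.I * v - s)⁻¹) +
      (∫ v : ℝ, completedRiemannZeta₀ (2 * Complex.I * v) * (2 * Complex.I * v - (1 - s))⁻¹) =
      -Real.pi * completedRiemannZeta₀ s := by
  have hc : IntegrableOn (fun x : ℝ ↦ (x : ℂ) ^ (s / 2 - 1) * thetaCut x) (Ioi 0) :=
    mellinConvergent_thetaCut (s / 2)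
  rw [integral_completedRiemannZeta₀_mul_inv_sub h0,
    integral_completedRiemannZeta₀_mul_inv_sub (s := 1 - s) (by simpa using h1),
    integral_Ioc_thetaCut_one_sub, ← mul_add, ← setIntegral_union (Ioc_disjoint_Ioi le_rfl)
      measurableSet_Ioi (hc.mono_set Ioc_subset_Ioi_self)
      (hc.mono_set (Ioi_subset_Ioi zero_le_one)), Ioc_union_Ioi_eq_Ioi zero_le_one]
  have := mellin_thetaCut (s / 2)
  rw [mul_div_cancel₀ _ two_ne_zero, mellin] at this
  simp only [smul_eq_mul] at this
  rw [this]
  ring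

/-! ### Rational integrals on the line `Re w = 0`. -/

lemma two_mul_I_mul_sub_ne_zero {a : ℂ} (ha : a.re ≠ 0) (v : ℝ) : 2 * Complex.I * v - a ≠ 0 :=
  fun h ↦ ha (by simpa using congrArg Complex.re h)

lemma norm_inv_two_mul_I_mul_sub_le {a : ℂ} (ha : a.re ≠ 0) (v : ℝ) :
    ‖(2 * Complex.I * v - a)⁻¹‖ ≤ |a.re|⁻¹ := by
  rw [norm_inv]
  have := Complex.abs_re_le_norm (2 * Complex.I * v - a)
  simp only [Complex.sub_re, Complex.mul_re, Complex.re_ofNat, Complex.I_re, mul_zero,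
    Complex.im_ofNat, Complex.I_im, mul_one, sub_self, Complex.ofReal_re, zero_mul, Complex.mul_im,
    Complex.ofReal_im, zero_sub, abs_neg, add_zero] at this
  have h := abs_pos.mpr ha
  gcongr

lemma continuous_inv_two_mul_I_mul_sub {a : ℂ} (ha : a.re ≠ 0) :
    Continuous fun v : ℝ ↦ (2 * Complex.I * v - a)⁻¹ :=
  Continuous.inv₀ (by fun_prop) (two_mul_I_mul_sub_ne_zero ha)

lemma integrable_norm_inv_two_mul_I_mul_sub_sq {a : ℂ} (ha : a.re ≠ 0) :
    Integrable fun v : ℝ ↦ ‖(2 * Complex.I * v - a)⁻¹‖ ^ 2 := by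
  have h := ((integrable_inv_one_add_sq.comp_mul_left' (g := fun x : ℝ ↦ (1 + x ^ 2)⁻¹)
    (R := 2 / a.re) (by positivity)).comp_sub_right (a.im / 2)).const_mul (a.re ^ 2)⁻¹
  refine h.congr (ae_of_all _ fun v ↦ ?_)
  have h1 : ‖2 * Complex.I * v - a‖ ^ 2 = a.re ^ 2 + (2 * v - a.im) ^ 2 := by
    rw [← Complex.normSq_eq_norm_sq, Complex.normSq_apply]
    simp
    ring
  simp only
  rw [norm_inv, inv_pow, h1, ← mul_inv]
  congr 1
  field_simp

lemma integrable_inv_mul_inv {a b : ℂ} (ha : a.re ≠ 0) (hb : b.re ≠ 0) :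
    Integrable fun v : ℝ ↦ (2 * Complex.I * v - a)⁻¹ * (2 * Complex.I * v - b)⁻¹ := by
  refine ((integrable_norm_inv_two_mul_I_mul_sub_sq ha).add
    (integrable_norm_inv_two_mul_I_mul_sub_sq hb)).mono'
    ((continuous_inv_two_mul_I_mul_sub ha).mul
      (continuous_inv_two_mul_I_mul_sub hb)).aestronglyMeasurable (ae_of_all _ fun v ↦ ?_)
  rw [norm_mul, Pi.add_apply]
  nlinarith [sq_nonneg (‖(2 * Complex.I * v - a)⁻¹‖ - ‖(2 * Complex.I * v - b)⁻¹‖),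
    sq_nonneg (‖(2 * Complex.I * v - a)⁻¹‖), sq_nonneg (‖(2 * Complex.I * v - b)⁻¹‖)]

/-- Both logarithms equal `log v` plus a term tending to `log c`, as `c` is off the branch cut. -/
lemma tendsto_log_add_mul_sub_log {a b c : ℂ} (ha : 0 < a.re) (hb : 0 < b.re) (hc : c.im ≠ 0)
    (hc0 : c.re = 0) :
    Tendsto (fun v : ℝ ↦ Complex.log (a + c * v) - Complex.log (b + c * v)) atTop (𝓝 0) := by
  have hlim (z : ℂ) : Tendsto (fun v : ℝ ↦ Complex.log (z * (v⁻¹ : ℝ) + c)) atTop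
      (𝓝 (Complex.log c)) := by
    refine ((continuousAt_clog (Or.inr hc)).tendsto).comp ?_
    have h1 : Tendsto (fun v : ℝ ↦ ((v⁻¹ : ℝ) : ℂ)) atTop (𝓝 ((0 : ℝ) : ℂ)) :=
      (Complex.continuous_ofReal.tendsto 0).comp tendsto_inv_atTop_zero
    simpa using (h1.const_mul z).add_const c
  have h := (hlim a).sub (hlim b)
  rw [sub_self] at h
  refine h.congr' ?_
  filter_upwards [eventually_gt_atTop 0] with v hv
  have e (z : ℂ) (hz : 0 < z.re) : Complex.log (z + c * v) =
      Real.log v + Complex.log (z * (v⁻¹ : ℝ) + c) := by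
    rw [← Complex.log_ofReal_mul hv]
    · congr 1
      push_cast
      have : (v : ℂ) ≠ 0 := Complex.ofReal_ne_zero.mpr hv.ne'
      field_simp
    · intro h0
      have := congrArg Complex.re h0
      rw [Complex.add_re, Complex.re_mul_ofReal, hc0, add_zero, Complex.zero_re] at this
      exact (mul_pos hz (inv_pos.mpr hv)).ne' this
  rw [e a ha, e b hb]
  ring

/-- Both poles lie to the right of the line. Concretely, a difference of logarithms of `a - w` and
`b - w`, which stay in the right half-plane, is an antiderivative vanishing at both ends. -/
lemma integral_inv_mul_inv {a b : ℂ} (ha : 0 < a.re) (hb : 0 < b.re) (hab : a ≠ b) :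
    ∫ v : ℝ, (2 * Complex.I * v - a)⁻¹ * (2 * Complex.I * v - b)⁻¹ = 0 := by
  have hab' : a - b ≠ 0 := sub_ne_zero.mpr hab
  have hd (z : ℂ) (hz : 0 < z.re) (v : ℝ) : HasDerivAt (fun v : ℝ ↦ Complex.log
      (z + -2 * Complex.I * v)) (2 * Complex.I * (2 * Complex.I * v - z)⁻¹) v := by
    have h1 : HasDerivAt (fun v : ℝ ↦ z + -2 * Complex.I * v) (-2 * Complex.I) v := by
      simpa using ((Complex.ofRealCLM.hasDerivAt (x := v)).const_mul (-2 * Complex.I)).const_add z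
    have h2 := h1.clog_real (Or.inl (by simpa using hz))
    refine h2.congr_deriv ?_
    rw [show z + -2 * Complex.I * v = -(2 * Complex.I * v - z) by ring, neg_mul, neg_div_neg_eq,
      div_eq_mul_inv]
  have hderiv (v : ℝ) := ((hd a ha v).sub (hd b hb v)).div_const (2 * Complex.I * (a - b))
  have hbot : Tendsto (fun v : ℝ ↦ (Complex.log (a + -2 * Complex.I * v) -
      Complex.log (b + -2 * Complex.I * v)) / (2 * Complex.I * (a - b))) atBot (𝓝 0) := by
    have := (tendsto_log_add_mul_sub_log ha hb (c := 2 * Complex.I) (by simp) (by simp)).comp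
      tendsto_neg_atBot_atTop
    simpa [Function.comp_def] using this.div_const (2 * Complex.I * (a - b))
  have htop : Tendsto (fun v : ℝ ↦ (Complex.log (a + -2 * Complex.I * v) -
      Complex.log (b + -2 * Complex.I * v)) / (2 * Complex.I * (a - b))) atTop (𝓝 0) := by
    have := tendsto_log_add_mul_sub_log ha hb (c := -2 * Complex.I) (by simp) (by simp)
    simpa using this.div_const (2 * Complex.I * (a - b))
  have hderiv' (v : ℝ) : HasDerivAt (fun v : ℝ ↦ (Complex.log (a + -2 * Complex.I * v) -
      Complex.log (b + -2 * Complex.I * v)) / (2 * Complex.I * (a - b)))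
      ((2 * Complex.I * v - a)⁻¹ * (2 * Complex.I * v - b)⁻¹) v := by
    refine (hderiv v).congr_deriv ?_
    have h1 := two_mul_I_mul_sub_ne_zero ha.ne' v
    have h2 := two_mul_I_mul_sub_ne_zero hb.ne' v
    rw [← mul_sub, mul_div_mul_left _ _ (by simp), inv_sub_inv h1 h2]
    field_simp
    ring
  simpa using integral_of_hasDerivAt_of_tendsto hderiv' (integrable_inv_mul_inv ha.ne' hb.ne')
    hbot htop

/-! ### The transfer function and the identity on the whole line. -/

lemma transferM_eq {s : ℂ} (h0 : s.re ≠ 0) (h1 : s.re ≠ 1) (v : ℝ) :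
    transferM s v = (1 - s) * (2 * Complex.I * v - s)⁻¹ +
      s * (2 * Complex.I * v - (1 - s))⁻¹ := by
  have hA := two_mul_I_mul_sub_ne_zero h0 v
  have hB := two_mul_I_mul_sub_ne_zero (a := 1 - s) (by simpa [sub_eq_zero] using h1.symm) v
  have hB' : 2 * Complex.I * v - 1 + s ≠ 0 := fun h ↦ hB (by linear_combination h)
  rw [transferM, show 2 * Complex.I * v - (1 - s) = 2 * Complex.I * v - 1 + s by ring]
  field_simp
  ring

lemma continuous_transferM {s : ℂ} (h0 : s.re ≠ 0) (h1 : s.re ≠ 1) : Continuous (transferM s) := by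
  rw [show transferM s = _ from funext (transferM_eq h0 h1)]
  have h1' : (1 - s).re ≠ 0 := by simpa [sub_eq_zero] using h1.symm
  exact ((continuous_inv_two_mul_I_mul_sub h0).const_mul _).add
    ((continuous_inv_two_mul_I_mul_sub h1').const_mul _)

lemma exists_norm_transferM_le {s : ℂ} (h0 : s.re ≠ 0) (h1 : s.re ≠ 1) :
    ∃ C, ∀ v : ℝ, ‖transferM s v‖ ≤ C * (1 + 2 * |v|) := by
  have h1' : (1 - s).re ≠ 0 := by simpa [sub_eq_zero] using h1.symm
  refine ⟨‖1 - s‖ * |s.re|⁻¹ + ‖s‖ * |(1 - s).re|⁻¹, fun v ↦ ?_⟩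
  refine le_trans ?_ (le_mul_of_one_le_right (by positivity) (by linarith [abs_nonneg v]))
  rw [transferM_eq h0 h1]
  refine (norm_add_le _ _).trans ?_
  rw [norm_mul, norm_mul]
  gcongr
  · exact norm_inv_two_mul_I_mul_sub_le h0 v
  · exact norm_inv_two_mul_I_mul_sub_le h1' v

lemma integrable_transferM_mul {s : ℂ} (h0 : s.re ≠ 0) (h1 : s.re ≠ 1) :
    Integrable fun v : ℝ ↦ transferM s v * upsilonFn (2 * Complex.I * v) * (v : ℂ) := by
  obtain ⟨C, hC⟩ := exists_norm_transferM_le h0 h1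
  simpa only [mul_assoc] using
    integrable_mul_upsilonFn (continuous_transferM h0 h1).measurable hC

/-- `Γ(1 + s/2) = (s/2) Γ(s/2)` gives `ξ(s) = -s(1 - s)Λ(s)/2`, and the pole part of `Λ` contributes
the constant `1/2`. -/
lemma riemannXiFn_eq {s : ℂ} (h0 : 0 < s.re) (h1 : s ≠ 1) :
    riemannXiFn s = (1 - s * (1 - s) * completedRiemannZeta₀ s) / 2 := by
  have hs0 : s ≠ 0 := fun h ↦ by simp [h] at h0
  have hG : Complex.Gammaℝ s ≠ 0 := Complex.Gammaℝ_ne_zero_of_re_pos h0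
  have h := riemannZeta_def_of_ne_zero hs0
  rw [eq_div_iff hG, Complex.Gammaℝ_def] at h
  have hs1 : 1 - s ≠ 0 := sub_ne_zero.mpr h1.symm
  rw [riemannXiFn, add_comm (1 : ℂ), Complex.Gamma_add_one _ (by simpa using hs0),
    completedRiemannZeta₀_eq hs0 hs1, ← h]
  field_simp
  ring

lemma integral_transferM_mul {s : ℂ} (h0 : 0 < s.re) (h1 : s.re < 1) :
    ∫ v : ℝ, transferM s v * upsilonFn (2 * Complex.I * v) * (v : ℂ) =
      Real.pi / (2 * Complex.I) * (thetaThree 1 - 2 + 2 * riemannXiFn s) := by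
  have h1' : 0 < (1 - s).re := by simpa using h1
  have hs1 : s ≠ 1 := fun h ↦ by simp [h] at h1
  have hs0 : s ≠ 0 := fun h ↦ by simp [h] at h0
  have iL := integrable_completedRiemannZeta₀
  have iA : Integrable fun v : ℝ ↦
      completedRiemannZeta₀ (2 * Complex.I * v) * (2 * Complex.I * v - s)⁻¹ :=
    iL.mul_bdd (c := |s.re|⁻¹) (continuous_inv_two_mul_I_mul_sub h0.ne').aestronglyMeasurable
      (ae_of_all _ (norm_inv_two_mul_I_mul_sub_le h0.ne'))
  have iB : Integrable fun v : ℝ ↦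
      completedRiemannZeta₀ (2 * Complex.I * v) * (2 * Complex.I * v - (1 - s))⁻¹ :=
    iL.mul_bdd (c := |(1 - s).re|⁻¹) (continuous_inv_two_mul_I_mul_sub h1'.ne').aestronglyMeasurable
      (ae_of_all _ (norm_inv_two_mul_I_mul_sub_le h1'.ne'))
  have iC := integrable_inv_mul_inv (a := s) (b := 1) h0.ne' (by simp)
  have iD := integrable_inv_mul_inv (a := 1 - s) (b := 1) h1'.ne' (by simp)
  have hL : ∫ v : ℝ, completedRiemannZeta₀ (2 * Complex.I * v) = Real.pi * (thetaThree 1 - 1) := by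
    simpa [thetaCut] using integral_cpow_mul_completedRiemannZeta₀ one_pos
  have hAB := integral_completedRiemannZeta₀_mul_inv_add_inv h0 h1
  have hC := integral_inv_mul_inv (a := s) (b := 1) h0 (by simp) hs1
  have hD := integral_inv_mul_inv (a := 1 - s) (b := 1) h1' (by simp) (by simpa using hs0)
  -- With `v = w/(2i)`, the factor `w` is absorbed through `w/(w - a) = 1 + a/(w - a)` in the `Λ₀`
  -- part and cancels the pole at `0` in the other part.
  have hpt : ∀ᵐ v : ℝ, transferM s v * upsilonFn (2 * Complex.I * v) * (v : ℂ) =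
      1 / (2 * Complex.I) * (completedRiemannZeta₀ (2 * Complex.I * v) + s * (1 - s) *
        (completedRiemannZeta₀ (2 * Complex.I * v) * (2 * Complex.I * v - s)⁻¹ +
        completedRiemannZeta₀ (2 * Complex.I * v) * (2 * Complex.I * v - (1 - s))⁻¹) +
        ((1 - s) * ((2 * Complex.I * v - s)⁻¹ * (2 * Complex.I * v - 1)⁻¹) +
        s * ((2 * Complex.I * v - (1 - s))⁻¹ * (2 * Complex.I * v - 1)⁻¹))) := by
    filter_upwards [compl_mem_ae_iff.mpr (measure_singleton (0 : ℝ))] with v hv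
    have hv' : v ≠ 0 := hv
    have hw : 2 * Complex.I * v ≠ 0 := by simp [hv']
    have hA := two_mul_I_mul_sub_ne_zero h0.ne' v
    have hB := two_mul_I_mul_sub_ne_zero h1'.ne' v
    have hE := two_mul_I_mul_sub_ne_zero (a := 1) (by simp) v
    have hE' : 1 - 2 * Complex.I * v ≠ 0 := fun h ↦ hE (by linear_combination -h)
    rw [transferM_eq h0.ne' h1.ne, upsilonFn_two_mul_I hv', completedRiemannZeta₀_eq hw hE',
      show (v : ℂ) = 1 / (2 * Complex.I) * (2 * Complex.I * v) by
        rw [one_div, inv_mul_cancel_left₀ (by simp)]]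
    rw [show 2 * Complex.I * (1 / (2 * Complex.I) * (2 * Complex.I * v)) = 2 * Complex.I * v by
        rw [one_div, mul_inv_cancel_left₀ (by simp)]]
    generalize 2 * Complex.I * (v : ℂ) = w at *
    generalize completedRiemannZeta w = L
    rw [mul_left_comm]
    congr 1
    rw [show 1 - w = -(w - 1) by ring]
    field_simp
    ring
  rw [integral_congr_ae hpt, integral_const_mul, integral_add, integral_add iL, integral_const_mul,
    integral_add iA iB, integral_add (iC.const_mul _) (iD.const_mul _), integral_const_mul,
    integral_const_mul, hAB, hC, hD, hL, riemannXiFn_eq h0 hs1]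
  · ring
  · exact (iA.add iB).const_mul _
  · exact iL.add ((iA.add iB).const_mul _)
  · exact (iC.const_mul _).add (iD.const_mul _)

lemma one_sub_thetaThree_sub_riemannXiFn {s : ℂ} (h0 : 0 < s.re) (h1 : s.re < 1) :
    1 - (thetaThree 1 : ℂ) / 2 - riemannXiFn s = -(Complex.I / Real.pi) *
      ∫ v : ℝ, transferM s v * upsilonFn (2 * Complex.I * v) * (v : ℂ) := by
  rw [integral_transferM_mul h0 h1]
  have : (Real.pi : ℂ) ≠ 0 := by exact_mod_cast Real.pi_ne_zero
  have hI := Complex.I_ne_zero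
  field_simp
  ring

/-! ### Decay of `ξ` on the critical line and the first moment of `Υ`. -/

/-- The entire function `(1 - w (1 - w) Λ₀(w)) / 2` extending `riemannXiFn`. -/
noncomputable def entireXi (w : ℂ) : ℂ := (1 - w * (1 - w) * completedRiemannZeta₀ w) / 2

lemma differentiable_entireXi : Differentiable ℂ entireXi := by
  have := differentiable_completedZeta₀
  unfold entireXi
  fun_prop

lemma entireXi_one_sub (w : ℂ) : entireXi (1 - w) = entireXi w := by
  rw [entireXi, entireXi, completedRiemannZeta₀_one_sub]
  ring

lemma norm_entireXi_mul_I_le (v : ℝ) :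
    ‖entireXi (2 * Complex.I * v)‖ ≤ (1 + 2 * |v|) ^ 3 * Real.exp (-|v|) := by
  rcases eq_or_ne v 0 with rfl | hv
  · simp [entireXi]
    norm_num
  · have hw : 2 * Complex.I * v ≠ 0 := by simp [hv]
    have hw1 : 1 - 2 * Complex.I * v ≠ 0 := fun h ↦ by simpa using congrArg Complex.re h
    have e : entireXi (2 * Complex.I * v) = -(Complex.I * v * (1 - 2 * Complex.I * v) *
        completedRiemannZeta (2 * Complex.I * v)) := by
      rw [entireXi, completedRiemannZeta₀_eq hw hw1, mul_add, mul_one_div_cancel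
        (mul_ne_zero hw hw1)]
      ring
    have h1 := norm_completedRiemannZeta_mul_I_le hv
    have h2 : ‖1 - 2 * Complex.I * v‖ ≤ 1 + 2 * |v| := by
      simpa using norm_sub_le (1 : ℂ) (2 * Complex.I * v)
    rw [e, norm_neg, norm_mul, norm_mul, norm_mul, Complex.norm_I, one_mul, Complex.norm_real,
      Real.norm_eq_abs]
    calc _ = ‖1 - 2 * Complex.I * v‖ * (|v| * ‖completedRiemannZeta (2 * Complex.I * v)‖) := by ring
      _ ≤ (1 + 2 * |v|) * ((1 + 2 * |v|) ^ 2 * Real.exp (-|v|)) := by gcongr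
      _ = _ := by ring

lemma one_add_pow_mul_exp_neg_le {x : ℝ} (hx : 0 ≤ x) :
    (1 + 2 * x) ^ 4 * Real.exp (-x) ≤ 8 ^ 4 := by
  have h : (1 + 2 * x) ^ 4 ≤ 8 ^ 4 * Real.exp x := by
    -- `8` and `x/4` are chosen so that `1 + y ≤ e^y` at `y = x/4` gives exactly `e^x` after the
    -- fourth power.
    calc (1 + 2 * x) ^ 4 ≤ (8 * (x / 4 + 1)) ^ 4 := by gcongr; linarith
      _ ≤ (8 * Real.exp (x / 4)) ^ 4 := by gcongr; exact Real.add_one_le_exp _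
      _ = 8 ^ 4 * Real.exp x := by
        rw [mul_pow, ← Real.exp_nat_mul]
        congr 2
        push_cast
        ring
  rw [Real.exp_neg, ← div_eq_mul_inv, div_le_iff₀ (Real.exp_pos x)]
  exact h

/-- The Mellin integral of `thetaCut` converges absolutely at `0` and at `1`, and `t^(Re w/2 - 1) ≤
t^(-1) + t^0` throughout the strip. This supplies the a priori growth for Phragmén–Lindelöf. -/
lemma exists_norm_completedRiemannZeta₀_le :
    ∃ K : ℝ, 0 ≤ K ∧ ∀ w : ℂ, 0 ≤ w.re → w.re ≤ 1 → ‖completedRiemannZeta₀ w‖ ≤ K := by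
  have h0 := (mellinConvergent_thetaCut 0).norm
  have h1 := (mellinConvergent_thetaCut 1).norm
  refine ⟨1 / 2 * ∫ t in Ioi (0 : ℝ), (‖(t : ℂ) ^ ((0 : ℂ) - 1) • thetaCut t‖ +
    ‖(t : ℂ) ^ ((1 : ℂ) - 1) • thetaCut t‖), by positivity, fun w hw0 hw1 ↦ ?_⟩
  have h := mellin_thetaCut (w / 2)
  rw [mul_div_cancel₀ _ two_ne_zero] at h
  have h2 : completedRiemannZeta₀ w = 1 / 2 * mellin thetaCut (w / 2) := by
    rw [h]
    ring
  rw [h2, norm_mul, mellin]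
  simp only [norm_div, norm_one, Complex.norm_ofNat]
  refine mul_le_mul_of_nonneg_left ?_ (by norm_num)
  refine norm_integral_le_of_norm_le (h0.add h1)
    ((ae_restrict_iff' measurableSet_Ioi).mpr (ae_of_all _ fun t ht ↦ ?_))
  rw [mem_Ioi] at ht
  simp only [norm_smul, Complex.norm_cpow_eq_rpow_re_of_pos ht, ← add_mul]
  gcongr
  have hre : (w / 2 - 1).re = w.re / 2 - 1 := by simp
  simp only [hre, Complex.sub_re, Complex.zero_re, Complex.one_re]
  rcases le_total t 1 with h | h
  · exact (Real.rpow_le_rpow_of_exponent_ge ht h (by linarith)).trans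
      (le_add_of_nonneg_right (Real.rpow_nonneg ht.le _))
  · exact (Real.rpow_le_rpow_of_exponent_le h (by linarith)).trans
      (le_add_of_nonneg_left (Real.rpow_nonneg ht.le _))

/-- Exponential decay on the edges absorbs the factor `w + 2`, and Phragmén–Lindelöf carries the
bound inside. The factor is what forces `ξ` to decay like `1/|w|` there. -/
lemma norm_add_two_mul_entireXi_le {w : ℂ} (h0 : 0 ≤ w.re) (h1 : w.re ≤ 1) :
    ‖(w + 2) * entireXi w‖ ≤ 3 * 8 ^ 4 := by
  have hb (v : ℝ) (z : ℂ) (hz : ‖z‖ ≤ 3 * (1 + 2 * |v|)) :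
      ‖z * entireXi (2 * Complex.I * v)‖ ≤ 3 * 8 ^ 4 := by
    rw [norm_mul]
    calc _ ≤ (3 * (1 + 2 * |v|)) * ((1 + 2 * |v|) ^ 3 * Real.exp (-|v|)) := by
          gcongr
          exact norm_entireXi_mul_I_le v
      _ = 3 * ((1 + 2 * |v|) ^ 4 * Real.exp (-|v|)) := by ring
      _ ≤ _ := by
          gcongr
          exact one_add_pow_mul_exp_neg_le (abs_nonneg v)
  have hn (w : ℂ) (h0 : 0 ≤ w.re) (h1 : w.re ≤ 1) : ‖w‖ ≤ 1 + |w.im| :=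
    (Complex.norm_le_abs_re_add_abs_im w).trans (by rw [abs_of_nonneg h0]; linarith)
  have hn2 (w : ℂ) (h0 : 0 ≤ w.re) (h1 : w.re ≤ 1) : ‖w + 2‖ ≤ 3 * (1 + |w.im|) := by
    have := norm_add_le w 2
    rw [Complex.norm_ofNat] at this
    linarith [hn w h0 h1, abs_nonneg w.im]
  have h2v (y : ℝ) : 2 * |y / 2| = |y| := by rw [abs_div, abs_two]; ring
  refine PhragmenLindelof.vertical_strip (a := 0) (b := 1) (f := fun w ↦ (w + 2) * entireXi w)
    ?_ ?_ ?_ ?_ h0 h1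
  · exact ((differentiable_id.add_const 2).mul differentiable_entireXi).diffContOnCl
  · obtain ⟨K, hK0, hK⟩ := exists_norm_completedRiemannZeta₀_le
    -- Growth `exp(B exp(c|Im w|))` with `c < π` is permitted; polynomial growth fits with `c = 1`,
    -- `B = 3`.
    refine ⟨1, by linarith [Real.pi_gt_three], 3, IsBigO.of_bound (3 * (1 + 2 * K)) ?_⟩
    refine eventually_inf_principal.mpr (Eventually.of_forall fun w hw ↦ ?_)
    have hw0 : 0 ≤ w.re := hw.1.le
    have hw1 : w.re ≤ 1 := hw.2.le
    set y := |w.im| with hy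
    have hy0 : 0 ≤ y := abs_nonneg _
    have h1w : ‖1 - w‖ ≤ 1 + y := by
      simpa [hy] using hn (1 - w) (by simpa using hw1) (by simpa using hw0)
    have hX : ‖entireXi w‖ ≤ (1 + 2 * K) * (1 + y) ^ 2 := by
      rw [entireXi, norm_div, Complex.norm_ofNat]
      have h3 := norm_sub_le 1 (w * (1 - w) * completedRiemannZeta₀ w)
      rw [norm_one, norm_mul, norm_mul] at h3
      have h4 : ‖w‖ * ‖1 - w‖ * ‖completedRiemannZeta₀ w‖ ≤ (1 + y) * (1 + y) * K := by
        gcongr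
        · exact hn w hw0 hw1
        · exact hK w hw0 hw1
      nlinarith [mul_nonneg hK0 (sq_nonneg (1 + y))]
    have hexp : (1 + y) ^ 3 ≤ Real.exp (3 * Real.exp y) := by
      calc (1 + y) ^ 3 ≤ (Real.exp (Real.exp y)) ^ 3 := by
            gcongr
            have := Real.add_one_le_exp y
            have := Real.add_one_le_exp (Real.exp y)
            linarith
        _ = _ := by rw [← Real.exp_nat_mul]; norm_num
    rw [one_mul, Real.norm_of_nonneg (Real.exp_pos _).le, norm_mul]
    calc _ ≤ (3 * (1 + y)) * ((1 + 2 * K) * (1 + y) ^ 2) := by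
          gcongr
          exact hn2 w hw0 hw1
      _ = 3 * (1 + 2 * K) * (1 + y) ^ 3 := by ring
      _ ≤ _ := by gcongr
  · intro z hz
    have he : z = 2 * Complex.I * (z.im / 2 : ℝ) := by
      apply Complex.ext
      · simp [hz]
      · simp
        ring
    have := hb (z.im / 2) (z + 2) (by
      rw [h2v]
      exact hn2 z hz.ge (by linarith))
    rwa [← he] at this
  · intro z hz
    have he : 1 - z = 2 * Complex.I * (-z.im / 2 : ℝ) := by
      apply Complex.ext
      · simp [hz]
      · simp
        ring
    have := hb (-z.im / 2) (z + 2) (by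
      rw [h2v, abs_neg]
      exact hn2 z (by linarith) hz.le)
    rwa [← he, entireXi_one_sub] at this

lemma tendsto_riemannXiFn_half :
    Tendsto (fun t : ℝ ↦ riemannXiFn (1 / 2 + t * Complex.I)) atTop (𝓝 0) := by
  have hdiv : Tendsto (fun t : ℝ ↦ 3 * 8 ^ 4 * t⁻¹) atTop (𝓝 0) := by
    simpa using tendsto_inv_atTop_zero.const_mul (3 * 8 ^ 4 : ℝ)
  refine squeeze_zero_norm' ?_ hdiv
  filter_upwards [eventually_gt_atTop 0] with t ht
  have hre : (1 / 2 + t * Complex.I).re = 1 / 2 := by simp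
  rw [riemannXiFn_eq (by rw [hre]; norm_num) (fun h ↦ by rw [h] at hre; norm_num at hre)]
  have h := norm_add_two_mul_entireXi_le (w := 1 / 2 + t * Complex.I) (by rw [hre]; norm_num)
    (by rw [hre]; norm_num)
  rw [norm_mul, entireXi] at h
  have h2 : t ≤ ‖1 / 2 + t * Complex.I + 2‖ := by
    have := Complex.abs_im_le_norm (1 / 2 + t * Complex.I + 2)
    simp at this
    linarith [le_abs_self t]
  rw [← div_eq_mul_inv, le_div_iff₀ ht, mul_comm]
  exact (mul_le_mul_of_nonneg_right h2 (norm_nonneg _)).trans h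

lemma integral_upsilonFn_mul :
    ∫ v : ℝ, upsilonFn (2 * Complex.I * v) * v =
      Real.pi / (4 * Complex.I) * (thetaThree 1 - 2) := by
  have hre (t : ℝ) : (1 / 2 + t * Complex.I).re = 1 / 2 := by simp
  have hre' (t : ℝ) : (1 - (1 / 2 + t * Complex.I)).re = 1 / 2 := by simp; norm_num
  have hne (t : ℝ) : (1 / 2 + t * Complex.I).re ≠ 0 := by rw [hre]; norm_num
  have hne1 (t : ℝ) : (1 / 2 + t * Complex.I).re ≠ 1 := by rw [hre]; norm_num
  have hne' (t : ℝ) : (1 - (1 / 2 + t * Complex.I)).re ≠ 0 := by rw [hre']; norm_num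
  -- Writing `1 - s = (1 - w) + (w - s)` isolates the limit `2`. Both poles are at distance `1/2`
  -- from the line, so each inverse is at most `2` for every `t`.
  have hM (t v : ℝ) : transferM (1 / 2 + t * Complex.I) v = 2 + (1 - 2 * Complex.I * v) *
      ((2 * Complex.I * v - (1 / 2 + t * Complex.I))⁻¹ +
      (2 * Complex.I * v - (1 - (1 / 2 + t * Complex.I)))⁻¹) := by
    have h1 := two_mul_I_mul_sub_ne_zero (hne t) v
    have h2 := two_mul_I_mul_sub_ne_zero (hne' t) v
    rw [transferM_eq (hne t) (hne1 t)]
    generalize 1 / 2 + (t : ℂ) * Complex.I = s at *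
    field_simp
    ring
  have hbound (t v : ℝ) : ‖transferM (1 / 2 + t * Complex.I) v‖ ≤ 6 * (1 + 2 * |v|) := by
    have h1 := norm_inv_two_mul_I_mul_sub_le (hne t) v
    have h2 := norm_inv_two_mul_I_mul_sub_le (hne' t) v
    have h3 : ‖1 - 2 * Complex.I * v‖ ≤ 1 + 2 * |v| := by
      simpa using norm_sub_le (1 : ℂ) (2 * Complex.I * v)
    rw [hre] at h1
    rw [hre'] at h2
    norm_num at h1 h2
    rw [hM]
    calc _ ≤ ‖(2 : ℂ)‖ + ‖1 - 2 * Complex.I * v‖ *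
          (‖(2 * Complex.I * v - (1 / 2 + t * Complex.I))⁻¹‖ +
          ‖(2 * Complex.I * v - (1 - (1 / 2 + t * Complex.I)))⁻¹‖) := by
          refine (norm_add_le _ _).trans ?_
          rw [norm_mul]
          gcongr
          exact norm_add_le _ _
      _ ≤ 2 + (1 + 2 * |v|) * (2 + 2) := by
          rw [Complex.norm_ofNat]
          gcongr
          · rw [norm_inv]
            exact h1
          · rw [norm_inv]
            exact h2
      _ ≤ _ := by linarith [abs_nonneg v]
  have hinv (z : ℝ → ℂ) (hz : Tendsto (fun t ↦ |(z t).im|) atTop atTop) :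
      Tendsto (fun t ↦ (z t)⁻¹) atTop (𝓝 0) := by
    refine tendsto_inv₀_cobounded.comp ?_
    rw [← tendsto_norm_atTop_iff_cobounded]
    exact tendsto_atTop_mono (fun t ↦ Complex.abs_im_le_norm _) hz
  have hlim (v : ℝ) : Tendsto (fun t : ℝ ↦ transferM (1 / 2 + t * Complex.I) v) atTop (𝓝 2) := by
    simp_rw [hM]
    have h1 := hinv (fun t ↦ 2 * Complex.I * v - (1 / 2 + t * Complex.I)) (by
      refine tendsto_abs_atBot_atTop.comp ?_
      simpa [sub_eq_add_neg] using tendsto_atBot_add_const_left atTop (2 * v)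
        (tendsto_neg_atTop_atBot (G := ℝ)))
    have h2 := hinv (fun t ↦ 2 * Complex.I * v - (1 - (1 / 2 + t * Complex.I))) (by
      refine tendsto_abs_atTop_atTop.comp ?_
      simpa using tendsto_atTop_add_const_left atTop (2 * v) tendsto_id)
    simpa using ((h1.add h2).const_mul (1 - 2 * Complex.I * v)).const_add 2
  have hL : Tendsto (fun t : ℝ ↦ ∫ v : ℝ, transferM (1 / 2 + t * Complex.I) v *
      (upsilonFn (2 * Complex.I * v) * v)) atTop
      (𝓝 (∫ v : ℝ, 2 * (upsilonFn (2 * Complex.I * v) * v))) := by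
    refine tendsto_integral_filter_of_dominated_convergence
      (fun v ↦ 6 * ((1 + 2 * |v|) ^ 3 * Real.exp (-|v|))) ?_ ?_
      ((integrable_pow_mul_exp_neg_abs 3).const_mul 6) ?_
    · exact Eventually.of_forall fun t ↦ ((continuous_transferM (hne t) (hne1 t)).measurable.mul
        measurable_upsilonFn_mul).aestronglyMeasurable
    · exact Eventually.of_forall fun t ↦ ae_of_all _ (norm_mul_upsilonFn_le (hbound t))
    · exact ae_of_all _ fun v ↦ (hlim v).mul_const _
  have hR : Tendsto (fun t : ℝ ↦ ∫ v : ℝ, transferM (1 / 2 + t * Complex.I) v *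
      (upsilonFn (2 * Complex.I * v) * v)) atTop
      (𝓝 (Real.pi / (2 * Complex.I) * (thetaThree 1 - 2 + 2 * 0))) := by
    refine ((tendsto_riemannXiFn_half.const_mul 2).const_add _ |>.const_mul _).congr fun t ↦ ?_
    rw [← integral_transferM_mul (by rw [hre]; norm_num) (by rw [hre]; norm_num)]
    simp only [mul_assoc]
  have := tendsto_nhds_unique hL hR
  rw [integral_const_mul] at this
  rw [show (4 : ℂ) * Complex.I = 2 * (2 * Complex.I) by ring, ← div_div, div_right_comm]
  linear_combination this / 2

/-! ### Explicit kernels and folding at the origin. -/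

lemma transferMR_eq {σ t : ℝ} (h0 : σ ≠ 0) (h1 : σ ≠ 1) (v : ℝ) :
    transferMR (σ + t * Complex.I) v =
      (-(1 - σ) * σ - t * (2 * v - t)) / ((t - 2 * v) ^ 2 + σ ^ 2) +
      (-σ * (1 - σ) + t * (2 * v + t)) / ((t + 2 * v) ^ 2 + (1 - σ) ^ 2) := by
  rw [transferMR, transferM_eq (by simpa using h0) (by simpa using h1)]
  simp only [Complex.add_re, Complex.mul_re, Complex.inv_re, Complex.inv_im, Complex.normSq_apply,
    Complex.sub_re, Complex.sub_im, Complex.add_im, Complex.mul_im, Complex.ofReal_re,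
    Complex.ofReal_im, Complex.I_re, Complex.I_im, Complex.one_re, Complex.one_im, Complex.re_ofNat,
    Complex.im_ofNat]
  ring

lemma transferMI_eq {σ t : ℝ} (h0 : σ ≠ 0) (h1 : σ ≠ 1) (v : ℝ) :
    transferMI (σ + t * Complex.I) v =
      (-(1 - σ) * (2 * v - t) + t * σ) / ((t - 2 * v) ^ 2 + σ ^ 2) +
      (-σ * (2 * v + t) - t * (1 - σ)) / ((t + 2 * v) ^ 2 + (1 - σ) ^ 2) := by
  rw [transferMI, transferM_eq (by simpa using h0) (by simpa using h1)]
  simp only [Complex.add_re, Complex.mul_re, Complex.inv_re, Complex.inv_im, Complex.normSq_apply,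
    Complex.sub_re, Complex.sub_im, Complex.add_im, Complex.mul_im, Complex.ofReal_re,
    Complex.ofReal_im, Complex.I_re, Complex.I_im, Complex.one_re, Complex.one_im, Complex.re_ofNat,
    Complex.im_ofNat]
  ring

lemma upsilonFn_conj (s : ℂ) :
    upsilonFn ((starRingEnd ℂ) s) = (starRingEnd ℂ) (upsilonFn s) := by
  have hp : ((Real.pi : ℂ)).arg ≠ Real.pi := by
    rw [Complex.arg_ofReal_of_nonneg Real.pi_pos.le]
    exact Real.pi_ne_zero.symm
  have h2 : (starRingEnd ℂ) s / 2 = (starRingEnd ℂ) (s / 2) := by simp [map_ofNat]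
  have h3 : -(starRingEnd ℂ) s / 2 = (starRingEnd ℂ) (-s / 2) := by simp [map_ofNat]
  rw [upsilonFn, upsilonFn, riemannZeta_conj, h2, Complex.Gamma_conj, h3, Complex.cpow_conj _ _ hp,
    Complex.conj_ofReal, map_mul, map_mul]

lemma upsilonFn_neg (v : ℝ) : upsilonFn (2 * Complex.I * (-v : ℝ)) =
    (starRingEnd ℂ) (upsilonFn (2 * Complex.I * v)) := by
  rw [← upsilonFn_conj]
  congr 1
  simp [map_ofNat]

/-- Folding an integral over the real line at the origin. -/
lemma integral_eq_integral_Ioi_add_neg {f : ℝ → ℝ} (hf : Integrable f) :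
    ∫ v, f v = ∫ v in Ioi (0 : ℝ), (f v + f (-v)) := by
  rw [integral_add hf.integrableOn hf.comp_neg.integrableOn, integral_comp_neg_Ioi, neg_zero,
    add_comm, ← setIntegral_union (Iic_disjoint_Ioi le_rfl) measurableSet_Ioi hf.integrableOn
      hf.integrableOn, Iic_union_Ioi, setIntegral_univ]

/-- The kernels are the even and odd combinations of `M_R`, `M_I` that arise when `Υ(-2iv)` is
replaced by the conjugate of `Υ(2iv)`. Imaginary parts appear because (b) carries the factor `-i/π`.
-/
lemma folded_re_integrand (s : ℂ) (v : ℝ) :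
    (kernelT₁ s v * upsilonR v + (kernelT₂ s v - 4) * upsilonI v) * v =
      -((transferM s v * upsilonFn (2 * Complex.I * v) * (v : ℂ)).im +
        (transferM s (-v) * upsilonFn (2 * Complex.I * (-v : ℝ)) * ((-v : ℝ) : ℂ)).im) := by
  rw [upsilonFn_neg]
  simp only [kernelT₁, kernelT₂, transferMR, transferMI, upsilonR, upsilonI, Complex.mul_im,
    Complex.mul_re, Complex.ofReal_re, Complex.ofReal_im, Complex.conj_re, Complex.conj_im]
  ring

lemma folded_im_integrand (s : ℂ) (v : ℝ) :
    (kernelT₃ s v * upsilonR v + kernelT₄ s v * upsilonI v) * v =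
      (transferM s v * upsilonFn (2 * Complex.I * v) * (v : ℂ)).re +
        (transferM s (-v) * upsilonFn (2 * Complex.I * (-v : ℝ)) * ((-v : ℝ) : ℂ)).re := by
  rw [upsilonFn_neg]
  simp only [kernelT₃, kernelT₄, transferMR, transferMI, upsilonR, upsilonI, Complex.mul_im,
    Complex.mul_re, Complex.ofReal_re, Complex.ofReal_im, Complex.conj_re, Complex.conj_im]
  ring

lemma folded_upsilonI (v : ℝ) :
    2 * (upsilonI v * v) = (upsilonFn (2 * Complex.I * v) * (v : ℂ)).im +
      (upsilonFn (2 * Complex.I * (-v : ℝ)) * ((-v : ℝ) : ℂ)).im := by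
  rw [upsilonFn_neg]
  simp only [upsilonI, Complex.mul_im, Complex.ofReal_re, Complex.ofReal_im, Complex.conj_re,
    Complex.conj_im]
  ring

lemma integrable_upsilonFn_mul : Integrable fun v : ℝ ↦ upsilonFn (2 * Complex.I * v) * (v : ℂ) := by
  simpa using integrable_mul_upsilonFn (g := fun _ ↦ 1) measurable_const (C := 1)
    (fun v ↦ by simp)

lemma integrableOn_upsilonI_mul : IntegrableOn (fun v ↦ upsilonI v * v) (Ioi 0) := by
  have h := integrable_upsilonFn_mul.im
  refine (h.congr (ae_of_all _ fun v ↦ ?_)).integrableOn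
  simp [upsilonI]

/-- This moment, weighted by `4/π`, is the contribution of the constant `4` in `T₂`. -/
lemma integral_upsilonI_mul :
    ∫ v in Ioi (0 : ℝ), upsilonI v * v = Real.pi / 8 * (2 - thetaThree 1) := by
  have hi := integrable_upsilonFn_mul
  have h1 := integral_im hi
  have h2 := integral_eq_integral_Ioi_add_neg hi.im
  simp only [RCLike.im_to_complex, ← folded_upsilonI] at h1 h2
  rw [integral_const_mul, h1, integral_upsilonFn_mul] at h2
  have e : (Real.pi : ℂ) / (4 * Complex.I) * (thetaThree 1 - 2) =
      ((Real.pi / 4 * (2 - thetaThree 1) : ℝ) : ℂ) * Complex.I := by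
    have hI := Complex.I_ne_zero
    field_simp
    push_cast
    rw [Complex.I_sq]
    ring
  rw [e, Complex.im_ofReal_mul, Complex.I_im] at h2
  linarith

theorem mainTheorem5 (σ t : ℝ) (hσ₀ : 0 < σ) (hσ₁ : σ < 1) (s : ℂ)
    (hs : s = (σ : ℂ) + (t : ℂ) * Complex.I) :
    -- the explicit partial fraction form of the kernels
    (∀ v : ℝ,
      kernelT₁ s v =
        (2 * σ * v - t) / ((t - 2 * v) ^ 2 + (σ - 1) ^ 2)
        + (2 * (1 - σ) * v - t) / ((t - 2 * v) ^ 2 + σ ^ 2)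
        + (2 * σ * v + t) / ((t + 2 * v) ^ 2 + (σ - 1) ^ 2)
        + (2 * (1 - σ) * v + t) / ((t + 2 * v) ^ 2 + σ ^ 2) ∧
      kernelT₂ s v =
        (-t * (t - 2 * v) + (1 - σ) * σ) / ((t - 2 * v) ^ 2 + σ ^ 2)
        + (-t * (t - 2 * v) + (1 - σ) * σ) / ((t - 2 * v) ^ 2 + (1 - σ) ^ 2)
        + (-t * (t + 2 * v) + (1 - σ) * σ) / ((t + 2 * v) ^ 2 + σ ^ 2)
        + (-t * (t + 2 * v) + (1 - σ) * σ) / ((t + 2 * v) ^ 2 + (1 - σ) ^ 2) + 4 ∧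
      kernelT₃ s v =
        (-t * (t - 2 * v) - σ * (σ - 1)) / ((t - 2 * v) ^ 2 + (σ - 1) ^ 2)
        + (t * (t - 2 * v) + σ * (σ - 1)) / ((t - 2 * v) ^ 2 + σ ^ 2)
        + (t * (t + 2 * v) + σ * (σ - 1)) / ((t + 2 * v) ^ 2 + (σ - 1) ^ 2)
        + (-t * (t + 2 * v) - σ * (σ - 1)) / ((t + 2 * v) ^ 2 + σ ^ 2) ∧
      kernelT₄ s v =
        (-2 * v * (σ - 1) - t) / ((t - 2 * v) ^ 2 + σ ^ 2)
        + (-2 * σ * v + t) / ((t - 2 * v) ^ 2 + (σ - 1) ^ 2)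
        + (2 * σ * v + t) / ((t + 2 * v) ^ 2 + (σ - 1) ^ 2)
        + (2 * v * (σ - 1) - t) / ((t + 2 * v) ^ 2 + σ ^ 2)) ∧
    -- the equation on the whole line, for `c = -1`
    (MeasureTheory.Integrable
        (fun v : ℝ => transferM s v * upsilonFn (2 * Complex.I * v) * (v : ℂ)) ∧
      1 - (Real.pi : ℂ) ^ (1 / 4 : ℂ) / (2 * Complex.Gamma (3 / 4)) - riemannXiFn s =
        -(Complex.I / Real.pi) *
          ∫ v : ℝ, transferM s v * upsilonFn (2 * Complex.I * v) * (v : ℂ)) ∧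
    -- the folded equation for the real part, with the constant term
    (MeasureTheory.IntegrableOn
        (fun v : ℝ => (kernelT₁ s v * upsilonR v + (kernelT₂ s v - 4) * upsilonI v) * v)
        (Set.Ioi 0) ∧
      Real.pi ^ (1 / 4 : ℝ) / (2 * Real.Gamma (3 / 4)) - 1 =
        -(riemannXiFn s).re + 1 / Real.pi *
          ∫ v in Set.Ioi (0 : ℝ),
            (kernelT₁ s v * upsilonR v + (kernelT₂ s v - 4) * upsilonI v) * v) ∧
    -- the real part of `ξ`
    (MeasureTheory.IntegrableOn
        (fun v : ℝ => (kernelT₁ s v * upsilonR v + kernelT₂ s v * upsilonI v) * v)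
        (Set.Ioi 0) ∧
      (riemannXiFn s).re = 1 / Real.pi *
        ∫ v in Set.Ioi (0 : ℝ),
          (kernelT₁ s v * upsilonR v + kernelT₂ s v * upsilonI v) * v) ∧
    -- the imaginary part of `ξ`
    (MeasureTheory.IntegrableOn
        (fun v : ℝ => (kernelT₃ s v * upsilonR v + kernelT₄ s v * upsilonI v) * v)
        (Set.Ioi 0) ∧
      (riemannXiFn s).im = 1 / Real.pi *
        ∫ v in Set.Ioi (0 : ℝ),
          (kernelT₃ s v * upsilonR v + kernelT₄ s v * upsilonI v) * v) := by
  have hre : s.re = σ := by simp [hs]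
  have h0 : 0 < s.re := hre ▸ hσ₀
  have h1 : s.re < 1 := hre ▸ hσ₁
  have hint := integrable_transferM_mul h0.ne' h1.ne
  have hb := one_sub_thetaThree_sub_riemannXiFn h0 h1
  have hθ : Real.pi ^ (1 / 4 : ℝ) / (2 * Real.Gamma (3 / 4)) = thetaThree 1 / 2 := by
    rw [thetaThree_one, mul_comm, div_div]
  have hθc : (Real.pi : ℂ) ^ (1 / 4 : ℂ) / (2 * Complex.Gamma (3 / 4)) = (thetaThree 1 : ℂ) / 2 := by
    have hG : Complex.Gamma (3 / 4) = (Real.Gamma (3 / 4) : ℝ) := by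
      rw [← Complex.Gamma_ofReal]
      push_cast
      rfl
    have hp : (Real.pi : ℂ) ^ (1 / 4 : ℂ) = ((Real.pi ^ (1 / 4 : ℝ) : ℝ) : ℂ) := by
      rw [Complex.ofReal_cpow Real.pi_pos.le]
      push_cast
      rfl
    rw [hG, hp]
    exact_mod_cast congrArg Complex.ofReal hθ
  -- Isolating the real scalar `1/π` lets real and imaginary parts be taken through the product.
  have hbig : ∀ z : ℂ, -(Complex.I / Real.pi) * z = ((1 / Real.pi : ℝ) : ℂ) * (-Complex.I * z) := by
    intro z
    push_cast
    ring
  have hbre := congrArg Complex.re hb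
  have hbim := congrArg Complex.im hb
  rw [hbig, Complex.re_ofReal_mul] at hbre
  rw [hbig, Complex.im_ofReal_mul] at hbim
  have hhalf : (thetaThree 1 : ℂ) / 2 = ((thetaThree 1 / 2 : ℝ) : ℂ) := by push_cast; rfl
  rw [hhalf] at hbre hbim
  simp only [Complex.sub_re, Complex.one_re, Complex.ofReal_re, Complex.neg_re, Complex.mul_re,
    Complex.I_re, Complex.I_im, zero_mul, zero_sub, neg_mul, one_mul, neg_neg] at hbre
  simp only [Complex.sub_im, Complex.one_im, Complex.ofReal_im, Complex.mul_im,
    Complex.neg_im, Complex.I_re, Complex.I_im, zero_mul, zero_sub, neg_mul, one_mul,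
    sub_self, zero_add] at hbim
  have iIm := hint.im
  have iRe := hint.re
  have eIm := integral_im hint
  have eRe := integral_re hint
  have fIm := integral_eq_integral_Ioi_add_neg iIm
  have fRe := integral_eq_integral_Ioi_add_neg iRe
  have gIm := (iIm.add iIm.comp_neg).neg.integrableOn (s := Ioi 0)
  have gRe := (iRe.add iRe.comp_neg).integrableOn (s := Ioi 0)
  simp only [RCLike.im_to_complex, RCLike.re_to_complex] at eIm eRe fIm fRe gIm gRe
  have cInt : IntegrableOn (fun v : ℝ ↦ (kernelT₁ s v * upsilonR v +
      (kernelT₂ s v - 4) * upsilonI v) * v) (Ioi 0) :=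
    gIm.congr (ae_of_all _ fun v ↦ (folded_re_integrand s v).symm)
  have eInt : IntegrableOn (fun v : ℝ ↦ (kernelT₃ s v * upsilonR v +
      kernelT₄ s v * upsilonI v) * v) (Ioi 0) :=
    gRe.congr (ae_of_all _ fun v ↦ (folded_im_integrand s v).symm)
  have cVal : Real.pi ^ (1 / 4 : ℝ) / (2 * Real.Gamma (3 / 4)) - 1 =
      -(riemannXiFn s).re + 1 / Real.pi * ∫ v in Ioi (0 : ℝ),
        (kernelT₁ s v * upsilonR v + (kernelT₂ s v - 4) * upsilonI v) * v := by
    rw [setIntegral_congr_fun measurableSet_Ioi fun v _ ↦ folded_re_integrand s v, integral_neg,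
      ← fIm, eIm, hθ]
    linear_combination -hbre
  have dSplit : ∀ v : ℝ, (kernelT₁ s v * upsilonR v + kernelT₂ s v * upsilonI v) * v =
      (kernelT₁ s v * upsilonR v + (kernelT₂ s v - 4) * upsilonI v) * v +
        4 * (upsilonI v * v) := fun v ↦ by ring
  refine ⟨fun v ↦ ?_, ⟨hint, ?_⟩, ⟨cInt, cVal⟩, ⟨?_, ?_⟩, eInt, ?_⟩
  · simp only [kernelT₁, kernelT₂, kernelT₃, kernelT₄, hs, transferMR_eq hσ₀.ne' hσ₁.ne,
      transferMI_eq hσ₀.ne' hσ₁.ne]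
    refine ⟨?_, ?_, ?_, ?_⟩ <;> ring
  · rw [hθc]
    exact hb
  · simp_rw [dSplit]
    exact cInt.add (integrableOn_upsilonI_mul.const_mul 4)
  · simp_rw [dSplit]
    rw [integral_add cInt (integrableOn_upsilonI_mul.const_mul 4), integral_const_mul,
      integral_upsilonI_mul, mul_add]
    rw [hθ] at cVal
    -- The added moment is exactly minus the left side of (c), so the constant term disappears in
    -- (d).
    have : 1 / Real.pi * (4 * (Real.pi / 8 * (2 - thetaThree 1))) = 1 - thetaThree 1 / 2 := by
      have := Real.pi_ne_zero
      field_simp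
      ring
    rw [this]
    linarith
  · rw [setIntegral_congr_fun measurableSet_Ioi fun v _ ↦ folded_im_integrand s v, ← fRe, eRe]
    linear_combination -hbim
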